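/- Let $\mathfrak G\subset \mathrm{GL}_2(\mathbb C)$ be the group generated by $$T=\tfrac1{\sqrt2}\begin{pmatrix}1&1\\1&-1\end{pmatrix},\qquad D=\begin{pmatrix}1&0\\0&i\end{pmatrix}$$ (the Shephard–Todd group $G_9$), acting on $\mathbb C[x,y]$ by $(\sigma f)(\mathbf x)=f(\sigma\mathbf x)$, $\mathbf x=(x,y)^{\mathsf T}$, and let $\mathfrak R=\mathbb C[x,y]^{\mathfrak G}$. For a representation $\rho:\mathfrak G\to\mathrm{GL}_m(\mathbb C)$ let $$M(\rho)=\{F\in\mathbb C[x,y]^m : F(\sigma\mathbf x)=\rho(\sigma)F(\mathbf x)\ \text{for all }\sigma\in\mathfrak G\},$$ an $\mathfrak R$-module graded by degree, and $\Phi_{M(\rho)}(t)=\sum_{k\ge0}\dim_{\mathbb C}M(\rho)_k\,t^k$, where $M(\rho)_k$ is the space of elements of $M(\rho)$ all of whose components are homogeneous of degree $k$. Let $\rho_2,\rho_3,\rho_4$ be the linear characters of $\mathfrak G$ with $T\mapsto1$ and $D\mapsto-1,\ i,\ -i$ respectively, let $\rho_{29}$ be the four-dimensional representation with $$\rho_{29}(T)=\frac1{2\sqrt2}\begin{pmatrix}1&3&3&1\\1&1&-1&-1\\1&-1&-1&1\\1&-3&3&-1\end{pmatrix},\qquad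 \rho_{29}(D)=\mathrm{diag}(1,i,-1,-i),$$ and let $\rho_{30}=\rho_2\otimes\rho_{29}$, $\rho_{31}=\rho_3\otimes\rho_{29}$, $\rho_{32}=\rho_4\otimes\rho_{29}$. Put $\Gamma=-x^5y+xy^5$, $\Delta=x^{12}-33x^8y^4-33x^4y^8+y^{12}$ and $J=\Delta\Gamma^3$, which has degree $30$, and $(\tau f)(x,y)=f(y,x)$. Consider the table $$\begin{array}{c|c|c|c|c} i & (d_{i,1},d_{i,2},d_{i,3},d_{i,4}) & c_i & \varepsilon_i & \text{series}\\ \hline 29 & (3,11,19,27) & 3276 & 1 & t^3+2t^{11}+3t^{19}+5t^{27}+6t^{35}+\cdots\\ 30 & (7,15,15,23) & -11780 & 1 & t^7+3t^{15}+4t^{23}+5t^{31}+7t^{39}+\cdots\\ 31 & (9,9,17,25) & 344960 & -1 & 2t^9+3t^{17}+4t^{25}+6t^{33}+7t^{41}+\cdots\\ 32 & (5,13,21,21) & 437400 & -1 & t^5+2t^{13}+4t^{21}+5t^{29}+6t^{37}+\cdots \end{array}$$ **Theorem.** For each $i\in\{29,30,31,32\}$: 1. $M(\rho_i)$ is a free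 $\mathfrak R$-module of rank $4$. It has a homogeneous basis $\mathbf w^{(1)},\dots,\mathbf w^{(4)}$ with $\deg\mathbf w^{(k)}=d_{i,k}$ whose determinant (the $\mathbf w^{(k)}$ being the columns, in this order) is $$\det[\mathbf w^{(1)},\mathbf w^{(2)},\mathbf w^{(3)},\mathbf w^{(4)}]=c_i\,J^2=c_i\,\Delta^2\Gamma^6,$$ a polynomial of degree $d_{i,1}+d_{i,2}+d_{i,3}+d_{i,4}=60$, and such that for each $k$ there are polynomials $f,g$, homogeneous of degree $d_{i,k}$, with $\mathbf w^{(k)}=(f,\,g,\,\varepsilon_i\,\tau g,\,\varepsilon_i\,\tau f)^{\mathsf T}$. 2. For every homogeneous $\mathfrak R$-basis of $M(\rho_i)$ with four elements, the degrees are $d_{i,1},\dots,d_{i,4}$ up to order, the determinant is $c\,\Delta^2\Gamma^6$ for some $c\in\mathbb C^\times$, and each basis element has the form $(f,g,\varepsilon_i\tau g,\varepsilon_i\tau f)^{\mathsf T}$ with $f,g$ homogeneous of the degree of that element. 3. Every $M(\rho_i)_k$ is finite-dimensional over $\mathbb C$, and $$\Phi_{M(\rho_i)}(t)=\frac{t^{d_{i,1}}+t^{d_{i,2}}+t^{d_{i,3}}+t^{d_{i,4}}}{(1-t^8)(1-t^{24})};$$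 its expansion begins as in the last column of the table (all terms of degree less than $d_{i,1}+40$ are shown). -/

import Mathlib

open MvPolynomial

noncomputable section

namespace G9

/-! ### The group and its action on `ℂ[x, y]` -/

/-- The matrix `T = (1/√2) (1 1; 1 -1)`. -/
def matT : Matrix (Fin 2) (Fin 2) ℂ :=
  ((Real.sqrt 2 : ℝ) : ℂ)⁻¹ • !![1, 1; 1, -1]

/-- The matrix `D = diag(1, i)`. -/
def matD : Matrix (Fin 2) (Fin 2) ℂ :=
  !![1, 0; 0, Complex.I]

theorem sqrtTwo_mul_self : ((Real.sqrt 2 : ℝ) : ℂ) * ((Real.sqrt 2 : ℝ) : ℂ) = 2 := by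
  rw [← Complex.ofReal_mul, Real.mul_self_sqrt (by norm_num)]
  norm_num

theorem sqrtTwo_ne_zero : ((Real.sqrt 2 : ℝ) : ℂ) ≠ 0 := by
  intro h
  have := sqrtTwo_mul_self
  rw [h] at this
  norm_num at this

theorem sqrtTwo_inv_mul_self :
    ((Real.sqrt 2 : ℝ) : ℂ)⁻¹ * ((Real.sqrt 2 : ℝ) : ℂ)⁻¹ = 1 / 2 := by
  rw [← mul_inv, sqrtTwo_mul_self, one_div]

theorem det_matT : matT.det = -1 := by
  have h := sqrtTwo_inv_mul_self
  simp only [matT, Matrix.det_fin_two, Matrix.smul_apply, Matrix.of_apply, Matrix.cons_val',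
    Matrix.cons_val_zero, Matrix.cons_val_one, Matrix.cons_val_fin_one, smul_eq_mul]
  linear_combination (-2) * h

theorem det_matD : matD.det = Complex.I := by
  simp [matD, Matrix.det_fin_two]

/-- `T` as an element of `GL(2, ℂ)`. -/
def T : GL (Fin 2) ℂ := Matrix.GeneralLinearGroup.mkOfDetNeZero matT (by simp [det_matT])

/-- `D` as an element of `GL(2, ℂ)`. -/
def D : GL (Fin 2) ℂ := Matrix.GeneralLinearGroup.mkOfDetNeZero matD (by simp [det_matD])

theorem coe_T : (T : Matrix (Fin 2) (Fin 2) ℂ) = matT := rfl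

theorem coe_D : (D : Matrix (Fin 2) (Fin 2) ℂ) = matD := rfl

/-- The group `𝔊`, generated by `T` and `D`. -/
def grp : Subgroup (GL (Fin 2) ℂ) := Subgroup.closure {T, D}

/-- `T` as an element of `𝔊`. -/
def gT : grp := ⟨T, Subgroup.subset_closure (by simp)⟩

/-- `D` as an element of `𝔊`. -/
def gD : grp := ⟨D, Subgroup.subset_closure (by simp)⟩

/-- The polynomial ring `ℂ[x, y]`; `x = X 0`, `y = X 1`. -/
abbrev Poly : Type := MvPolynomial (Fin 2) ℂ

/-- The substitution `f(𝐱) ↦ f(A 𝐱)`. -/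
def subst (A : Matrix (Fin 2) (Fin 2) ℂ) : Poly →ₐ[ℂ] Poly :=
  aeval fun i => ∑ j, C (A i j) * X j

/-- The invariant ring `ℜ = ℂ[x, y]^𝔊`. -/
def invRing : Subalgebra ℂ Poly where
  carrier := {f | ∀ g : grp, subst (g : GL (Fin 2) ℂ) f = f}
  mul_mem' ha hb g := by rw [map_mul, ha g, hb g]
  add_mem' ha hb g := by rw [map_add, ha g, hb g]
  algebraMap_mem' r g := AlgHom.commutes _ r

/-! ### Covariants -/

/-- The `ℜ`-module `M(ρ)` of all `F ∈ ℂ[x, y]^m` with `F(σ𝐱) = ρ(σ) F(𝐱)` for all `σ ∈ 𝔊`. -/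
def covariants {m : ℕ} (ρ : grp →* GL (Fin m) ℂ) : Submodule invRing (Fin m → Poly) where
  carrier := {F | ∀ (σ : grp) (r : Fin m),
    subst (σ : GL (Fin 2) ℂ) (F r) = ∑ s, C ((ρ σ : Matrix (Fin m) (Fin m) ℂ) r s) * F s}
  zero_mem' σ r := by simp
  add_mem' {F G} hF hG σ r := by
    simp only [Pi.add_apply, map_add, hF σ r, hG σ r, mul_add, Finset.sum_add_distrib]
  smul_mem' a {F} hF σ r := by
    have h1 : (a • F) = fun s => (a : Poly) * F s := rfl
    rw [h1]
    simp only [map_mul, a.2 σ, hF σ r, Finset.mul_sum]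
    exact Finset.sum_congr rfl fun s _ => by ring

/-- A vector of polynomials, all of whose components are homogeneous of degree `d`. -/
def IsHomogeneousVec {m : ℕ} (F : Fin m → Poly) (d : ℕ) : Prop :=
  ∀ r, (F r).IsHomogeneous d

/-- The space `M(ρ)_k` of homogeneous covariants of degree `k`. -/
def covariantsDeg {m : ℕ} (ρ : grp →* GL (Fin m) ℂ) (k : ℕ) : Submodule ℂ (Fin m → Poly) :=
  (covariants ρ).restrictScalars ℂ ⊓
    Submodule.pi Set.univ fun _ => homogeneousSubmodule (Fin 2) ℂ k

theorem mem_covariantsDeg {m : ℕ} (ρ : grp →* GL (Fin m) ℂ) (k : ℕ) (F : Fin m → Poly) :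
    F ∈ covariantsDeg ρ k ↔ F ∈ covariants ρ ∧ IsHomogeneousVec F k := by
  simp [covariantsDeg, IsHomogeneousVec, Submodule.mem_pi]

/-- The Hilbert series `Φ_{M(ρ)}(t) = ∑ dim_ℂ M(ρ)_k t^k`. -/
def hilbertSeries {m : ℕ} (ρ : grp →* GL (Fin m) ℂ) : PowerSeries ℤ :=
  PowerSeries.mk fun k => (Module.finrank ℂ (covariantsDeg ρ k) : ℤ)

/-! ### The polynomials `Γ`, `Δ`, `J` and the involution `τ` -/

/-- `Γ = -x⁵y + xy⁵`. -/
def Gam : Poly := -(X 0 ^ 5 * X 1) + X 0 * X 1 ^ 5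

/-- `Δ = x¹² - 33x⁸y⁴ - 33x⁴y⁸ + y¹²`. -/
def Del : Poly := X 0 ^ 12 - 33 * X 0 ^ 8 * X 1 ^ 4 - 33 * X 0 ^ 4 * X 1 ^ 8 + X 1 ^ 12

/-- `J = Δ Γ³`. -/
def J : Poly := Del * Gam ^ 3

/-- The involution `f(x, y) ↦ f(y, x)` of `ℂ[x, y]`. -/
def tau : Poly →ₐ[ℂ] Poly := rename (Equiv.swap 0 1)

/-! ### The linear characters with `T ↦ 1` -/

/-- The function `Γ` on `ℂ²`. -/
def gamFun (v : Fin 2 → ℂ) : ℂ := -(v 0 ^ 5 * v 1) + v 0 * v 1 ^ 5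

theorem gamFun_T (v : Fin 2 → ℂ) : gamFun (matT.mulVec v) = gamFun v := by
  have h := sqrtTwo_inv_mul_self
  set s : ℂ := ((Real.sqrt 2 : ℝ) : ℂ)⁻¹ with hs
  have h0 : matT.mulVec v 0 = s * (v 0 + v 1) := by
    simp [matT, Matrix.mulVec, dotProduct, Fin.sum_univ_two, ← hs]; ring
  have h1 : matT.mulVec v 1 = s * (v 0 - v 1) := by
    simp [matT, Matrix.mulVec, dotProduct, Fin.sum_univ_two, ← hs]; ring
  have h6 : s ^ 6 = 1 / 8 := by
    have : s ^ 6 = (s * s) ^ 3 := by ring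
    rw [this, h]; norm_num
  simp only [gamFun, h0, h1]
  linear_combination
    (-((v 0 + v 1) ^ 5 * (v 0 - v 1)) + (v 0 + v 1) * (v 0 - v 1) ^ 5) * h6

theorem gamFun_D (v : Fin 2 → ℂ) : gamFun (matD.mulVec v) = Complex.I * gamFun v := by
  have h0 : matD.mulVec v 0 = v 0 := by
    simp [matD, Matrix.mulVec, dotProduct, Fin.sum_univ_two]
  have h1 : matD.mulVec v 1 = Complex.I * v 1 := by
    simp [matD, Matrix.mulVec, dotProduct, Fin.sum_univ_two]
  have h5 : Complex.I ^ 5 = Complex.I := by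
    have : Complex.I ^ 5 = (Complex.I ^ 2) ^ 2 * Complex.I := by ring
    rw [this, Complex.I_sq]; ring
  simp only [gamFun, h0, h1]
  linear_combination (v 0 * v 1 ^ 5) * h5

/-- The factor by which `g` scales `Γ`, read off at the point `(1, 2)`. -/
def chiVal (A : Matrix (Fin 2) (Fin 2) ℂ) : ℂ := gamFun (A.mulVec ![1, 2]) / 30

theorem gamFun_point : gamFun ![1, 2] = 30 := by
  simp [gamFun]; norm_num

theorem chiVal_eq {A : Matrix (Fin 2) (Fin 2) ℂ} {c : ℂ}
    (h : ∀ v, gamFun (A.mulVec v) = c * gamFun v) : chiVal A = c := by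
  rw [chiVal, h, gamFun_point]; field_simp

theorem exists_scale (g : grp) :
    ∃ c : ℂ, ∀ v, gamFun (((g : GL (Fin 2) ℂ) : Matrix (Fin 2) (Fin 2) ℂ).mulVec v)
      = c * gamFun v := by
  obtain ⟨g, hg⟩ := g
  change ∃ c : ℂ, ∀ v, gamFun ((g : Matrix (Fin 2) (Fin 2) ℂ).mulVec v) = c * gamFun v
  induction hg using Subgroup.closure_induction with
  | mem x hx =>
    rcases hx with rfl | rfl
    · exact ⟨1, fun v => by rw [coe_T, gamFun_T, one_mul]⟩
    · exact ⟨Complex.I, fun v => by rw [coe_D, gamFun_D]⟩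
  | one => exact ⟨1, fun v => by simp⟩
  | mul x y _ _ hx hy =>
    obtain ⟨a, ha⟩ := hx
    obtain ⟨b, hb⟩ := hy
    refine ⟨a * b, fun v => ?_⟩
    rw [Units.val_mul, ← Matrix.mulVec_mulVec, ha, hb, mul_assoc]
  | inv x _ hx =>
    obtain ⟨a, ha⟩ := hx
    have key : ∀ v, gamFun v = a * gamFun (((x⁻¹ : GL (Fin 2) ℂ) :
        Matrix (Fin 2) (Fin 2) ℂ).mulVec v) := by
      intro v
      rw [← ha, Matrix.mulVec_mulVec, ← Units.val_mul, mul_inv_cancel, Units.val_one,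
        Matrix.one_mulVec]
    have ha0 : a ≠ 0 := by
      intro h0
      have := key ![1, 2]
      rw [gamFun_point, h0, zero_mul] at this
      norm_num at this
    exact ⟨a⁻¹, fun v => by rw [key v, inv_mul_cancel_left₀ ha0]⟩

theorem gamFun_mulVec (g : grp) (v : Fin 2 → ℂ) :
    gamFun (((g : GL (Fin 2) ℂ) : Matrix (Fin 2) (Fin 2) ℂ).mulVec v)
      = chiVal (g : GL (Fin 2) ℂ) * gamFun v := by
  obtain ⟨c, hc⟩ := exists_scale g
  rw [chiVal_eq hc, hc]

/-- The linear character `ρ₃` of `𝔊`, with `T ↦ 1` and `D ↦ i`. -/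
def rho3 : grp →* ℂˣ :=
  MonoidHom.toHomUnits
    { toFun := fun g => chiVal (g : GL (Fin 2) ℂ)
      map_one' := chiVal_eq fun v => by simp
      map_mul' := fun g h => chiVal_eq fun v => by
        rw [Subgroup.coe_mul, Units.val_mul, ← Matrix.mulVec_mulVec, gamFun_mulVec,
          gamFun_mulVec, mul_assoc] }

/-- The linear character `ρ₂` of `𝔊`, with `T ↦ 1` and `D ↦ -1`. -/
def rho2 : grp →* ℂˣ := rho3 ^ 2

/-- The linear character `ρ₄` of `𝔊`, with `T ↦ 1` and `D ↦ -i`. -/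
def rho4 : grp →* ℂˣ := rho3 ^ 3

theorem rho3_T : (rho3 gT : ℂ) = 1 := chiVal_eq fun v => by rw [one_mul]; exact gamFun_T v

theorem rho3_D : (rho3 gD : ℂ) = Complex.I := chiVal_eq fun v => gamFun_D v

theorem rho2_T : (rho2 gT : ℂ) = 1 := by simp [rho2, rho3_T]

theorem rho2_D : (rho2 gD : ℂ) = -1 := by simp [rho2, rho3_D]

theorem rho4_T : (rho4 gT : ℂ) = 1 := by simp [rho4, rho3_T]

theorem rho4_D : (rho4 gD : ℂ) = -Complex.I := by
  simp [rho4, rho3_D]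

/-! ### The four-dimensional representations -/

/-- The symmetric cube of a `2 × 2` matrix. Its rows are the coefficients of `u³`, `u²v`, `uv²`,
`v³` with respect to `x³`, `x²y`, `xy²`, `y³`, where `(u, v)ᵀ = A (x, y)ᵀ`. -/
def symCube : Matrix (Fin 2) (Fin 2) ℂ →* Matrix (Fin 4) (Fin 4) ℂ where
  toFun A :=
    let a := A 0 0
    let b := A 0 1
    let c := A 1 0
    let d := A 1 1
    !![a ^ 3, 3 * a ^ 2 * b, 3 * a * b ^ 2, b ^ 3;
       a ^ 2 * c, a ^ 2 * d + 2 * a * b * c, b ^ 2 * c + 2 * a * b * d, b ^ 2 * d;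
       a * c ^ 2, b * c ^ 2 + 2 * a * c * d, a * d ^ 2 + 2 * b * c * d, b * d ^ 2;
       c ^ 3, 3 * c ^ 2 * d, 3 * c * d ^ 2, d ^ 3]
  map_one' := by
    ext i j
    fin_cases i <;> fin_cases j <;> simp
  map_mul' A B := by
    ext i j
    fin_cases i <;> fin_cases j <;>
      simp [Matrix.mul_apply, Fin.sum_univ_two, Fin.sum_univ_four] <;> ring

/-- The representation `ρ₂₉`: the symmetric cube of the natural representation. -/
def rho29 : grp →* GL (Fin 4) ℂ := (Units.map symCube).comp grp.subtype

theorem rho29_T : (rho29 gT : Matrix (Fin 4) (Fin 4) ℂ) =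
    (2 * ((Real.sqrt 2 : ℝ) : ℂ))⁻¹ •
      !![1, 3, 3, 1; 1, 1, -1, -1; 1, -1, -1, 1; 1, -3, 3, -1] := by
  have h := sqrtTwo_inv_mul_self
  change symCube matT = _
  rw [mul_inv]
  simp only [matT]
  set s : ℂ := ((Real.sqrt 2 : ℝ) : ℂ)⁻¹
  have h2 : s ^ 2 = 2⁻¹ := by linear_combination h
  have h3 : s ^ 3 = 2⁻¹ * s := by linear_combination s * h
  ext i j
  fin_cases i <;> fin_cases j <;> simp [symCube] <;>
    first
      | exact Or.inl h2
      | linear_combination h3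
      | linear_combination (-1) * h3
      | linear_combination 3 * h3
      | linear_combination (-3) * h3

theorem rho29_D : (rho29 gD : Matrix (Fin 4) (Fin 4) ℂ) =
    Matrix.diagonal ![1, Complex.I, -1, -Complex.I] := by
  change symCube matD = _
  ext i j
  fin_cases i <;> fin_cases j <;> simp [symCube, matD]

/-- The twist `χ ⊗ ρ` of a matrix representation by a linear character. -/
def twist {m : ℕ} (χ : grp →* ℂˣ) (ρ : grp →* GL (Fin m) ℂ) : grp →* GL (Fin m) ℂ :=
  MonoidHom.toHomUnits
    { toFun := fun g => (χ g : ℂ) • (ρ g : Matrix (Fin m) (Fin m) ℂ)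
      map_one' := by simp
      map_mul' := fun g h => by simp [smul_smul, mul_comm] }

theorem coe_twist {m : ℕ} (χ : grp →* ℂˣ) (ρ : grp →* GL (Fin m) ℂ) (g : grp) :
    (twist χ ρ g : Matrix (Fin m) (Fin m) ℂ) = (χ g : ℂ) • (ρ g : Matrix (Fin m) (Fin m) ℂ) :=
  rfl

/-- The four representations `ρ₂₉`, `ρ₃₀ = ρ₂ ⊗ ρ₂₉`, `ρ₃₁ = ρ₃ ⊗ ρ₂₉`, `ρ₃₂ = ρ₄ ⊗ ρ₂₉`;
the index `j` stands for `ρ_{29+j}`, here and in the tables below. -/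
def rho (j : Fin 4) : grp →* GL (Fin 4) ℂ :=
  ![rho29, twist rho2 rho29, twist rho3 rho29, twist rho4 rho29] j

/-! ### The tables -/

/-- The generator degrees. -/
def degs (j : Fin 4) : Fin 4 → ℕ :=
  ![![3, 11, 19, 27], ![7, 15, 15, 23], ![9, 9, 17, 25], ![5, 13, 21, 21]] j

/-- The first five nonzero coefficients of the Hilbert series; the `l`-th one belongs to the
exponent `degs j 0 + 8 * l`. -/
def firstCoeffs (j : Fin 4) : Fin 5 → ℤ :=
  ![![1, 2, 3, 5, 6], ![1, 3, 4, 5, 7], ![2, 3, 4, 6, 7], ![1, 2, 4, 5, 6]] j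

/-- The constants `c₂₉, c₃₀, c₃₁, c₃₂`. -/
def detConst (j : Fin 4) : ℂ := ![3276, -11780, 344960, 437400] j

/-- The sign in the symmetry pattern. -/
def swapSign (j : Fin 4) : ℂ := ![1, 1, -1, -1] j

/-- `F = (f, g, ε·τg, ε·τf)` for homogeneous `f, g` of degree `d`. -/
def HasSwapPattern (ε : ℂ) (d : ℕ) (F : Fin 4 → Poly) : Prop :=
  ∃ f g : Poly, f.IsHomogeneous d ∧ g.IsHomogeneous d ∧ F = ![f, g, ε • tau g, ε • tau f]

/-- The determinant of the matrix whose columns are the given four vectors, in this order. -/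
def colDet {M : Submodule invRing (Fin 4 → Poly)} (w : Fin 4 → M) : Poly :=
  (Matrix.of fun r k => (w k : Fin 4 → Poly) r).det

end G9

end

noncomputable section
namespace G9

/-! ### Generalities on the action -/

/-! All four representations are `ρ₃^m ⊗ Sym³` with `m = 0, 2, 1, 3` (`twistExp`), and `Γ` has
character `ρ₃`, so multiplication by `Γ` moves covariants from one of the four modules to another.

The core is a determinant criterion. The determinant of any four covariants is a semi-invariant of
weight `ρ₃²`, and reflections force it to vanish on their lines. The diagonal action of `D` makes
the rows divisible by powers of `y` with exponents `0, 1, 2, 3` in some order, hence `y⁶` divides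
the determinant. On the line fixed by `T` the two independent rows of `ρ(T) - 1` kill the
covariants, hence the square of that line divides it. Moving these lines around by the group gives
`Γ⁶` and `Δ²`, and the cofactor has trivial weight (`exists_det_colMat_eq`). If the cofactor is a
nonzero constant, Cramer's rule expresses every covariant with invariant coefficients, so the four
form a basis (`exists_basis_of_det`); conversely a change of basis shows that the cofactor of any
basis is constant (`colDet_basis`).

It remains to exhibit bases. One small covariant for each representation, of degrees `3, 7, 9, 5`,
is checked on `T` and `D`; their joint determinant is `±5Δ²`. For each target module they are
multiplied by `1, Γ, Γ², Γ³` in the order that makes the weights agree, which adds the factor `Γ⁶`.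

The symmetry holds for every covariant, since the transposition of the coordinates lies in the group
(`hasSwapPattern`). For the series, evaluation of invariants at `(1, 0)` has kernel `Γ⁴ℜ`, which
gives the Hilbert function of `ℜ` by recursion (`finrank_invDeg`); a homogeneous basis then gives
that of the module, and comparing two such expressions fixes the degrees. -/

theorem grp_induction {p : grp → Prop} (hT : p gT) (hD : p gD) (h1 : p 1)
    (hmul : ∀ a b, p a → p b → p (a * b)) (hinv : ∀ a, p a → p a⁻¹) (σ : grp) : p σ := by
  obtain ⟨g, hg⟩ := σ
  refine Subgroup.closure_induction (p := fun x hx => p ⟨x, hx⟩) ?_ h1 ?_ ?_ hg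
  · rintro x (rfl | rfl)
    · exact hT
    · exact hD
  · exact fun x y hx hy h h' => hmul ⟨x, hx⟩ ⟨y, hy⟩ h h'
  · exact fun x hx h => hinv ⟨x, hx⟩ h

theorem subst_X (A : Matrix (Fin 2) (Fin 2) ℂ) (i : Fin 2) :
    subst A (X i) = ∑ j, C (A i j) * X j := by
  simp [subst]

theorem subst_C (A : Matrix (Fin 2) (Fin 2) ℂ) (c : ℂ) : subst A (C c) = C c :=
  (subst A).commutes c

theorem subst_one (f : Poly) : subst 1 f = f := by
  have : subst 1 = AlgHom.id ℂ Poly := by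
    ext i : 1
    fin_cases i <;> simp [subst_X, Fin.sum_univ_two]
  rw [this, AlgHom.id_apply]

theorem subst_mul (A B : Matrix (Fin 2) (Fin 2) ℂ) (f : Poly) :
    subst (A * B) f = subst B (subst A f) := by
  have : subst (A * B) = (subst B).comp (subst A) := by
    ext i : 1
    simp only [subst_X, AlgHom.comp_apply, map_mul, subst_C, Matrix.mul_apply,
      Fin.sum_univ_two, map_add]
    ring
  rw [this, AlgHom.comp_apply]

theorem subst_isHomogeneous (A : Matrix (Fin 2) (Fin 2) ℂ) {f : Poly} {n : ℕ}
    (hf : f.IsHomogeneous n) : (subst A f).IsHomogeneous n := by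
  have := hf.aeval (fun i => ∑ j, C (A i j) * X j) (n := 1)
    (fun i => IsHomogeneous.sum _ _ _ fun j _ => isHomogeneous_C_mul_X _ _)
  rwa [one_mul] at this

/-- The factor `1/√2`. -/
def invSqrtTwo : ℂ := ((Real.sqrt 2 : ℝ) : ℂ)⁻¹

theorem invSqrtTwo_sq : invSqrtTwo ^ 2 = 1 / 2 := by
  rw [sq]; exact sqrtTwo_inv_mul_self

theorem subst_T_X0 : subst matT (X 0) = C invSqrtTwo * (X 0 + X 1) := by
  simp [subst_X, matT, Fin.sum_univ_two, invSqrtTwo]; ring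

theorem subst_T_X1 : subst matT (X 1) = C invSqrtTwo * (X 0 - X 1) := by
  simp [subst_X, matT, Fin.sum_univ_two, invSqrtTwo]; ring

theorem subst_D_X0 : subst matD (X 0) = X 0 := by
  simp [subst_X, matD, Fin.sum_univ_two]

theorem subst_D_X1 : subst matD (X 1) = C Complex.I * X 1 := by
  simp [subst_X, matD, Fin.sum_univ_two]

theorem C_I_sq : (C Complex.I : Poly) ^ 2 = -1 := by
  rw [← C_pow, Complex.I_sq, C_neg, C_1]

theorem C_invSqrtTwo_sq : (C invSqrtTwo : Poly) ^ 2 * 2 = 1 := by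
  rw [← C_pow, invSqrtTwo_sq, ← map_ofNat C 2, ← C_mul]
  norm_num

/-! ### Semi-invariants -/

/-- Polynomials that `𝔊` multiplies by the `m`-th power of the character `ρ₃`. -/
def SemiInv (m : ℕ) (f : Poly) : Prop :=
  ∀ σ : grp, subst (σ : GL (Fin 2) ℂ) f = C ((rho3 σ : ℂ) ^ m) * f

theorem semiInv_zero_iff {f : Poly} : SemiInv 0 f ↔ f ∈ invRing := by
  simp only [SemiInv, pow_zero, C_1, one_mul]; rfl

theorem semiInv_of_gen {m : ℕ} {f : Poly} (hT : subst matT f = f)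
    (hD : subst matD f = C (Complex.I ^ m) * f) : SemiInv m f := by
  refine fun σ => grp_induction (p := fun σ : grp =>
    subst (σ : GL (Fin 2) ℂ) f = C ((rho3 σ : ℂ) ^ m) * f) ?_ ?_ ?_ ?_ ?_ σ
  · rw [rho3_T, one_pow, C_1, one_mul]; exact hT
  · rw [rho3_D]; exact hD
  · simp [subst_one]
  · intro a b ha hb
    rw [Subgroup.coe_mul, Units.val_mul, subst_mul, ha, map_mul, subst_C, hb, map_mul,
      Units.val_mul, mul_pow, C_mul, mul_assoc]
  · intro a ha
    have h := congrArg (subst ((a⁻¹ : grp) : GL (Fin 2) ℂ)) ha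
    rw [← subst_mul, ← Units.val_mul, ← Subgroup.coe_mul, mul_inv_cancel, map_mul, subst_C,
      OneMemClass.coe_one, Units.val_one, subst_one] at h
    nth_rewrite 2 [h]
    rw [← mul_assoc, ← C_mul, ← mul_pow, ← Units.val_mul, ← map_mul, inv_mul_cancel]
    simp

theorem rho3_pow_four (σ : grp) : (rho3 σ : ℂ) ^ 4 = 1 := by
  refine grp_induction (p := fun σ => (rho3 σ : ℂ) ^ 4 = 1) ?_ ?_ ?_ ?_ ?_ σ
  · rw [rho3_T, one_pow]
  · rw [rho3_D, Complex.I_pow_four]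
  · simp
  · intro a b ha hb
    rw [map_mul, Units.val_mul, mul_pow, ha, hb, one_mul]
  · intro a ha
    rw [map_inv, Units.val_inv_eq_inv_val, inv_pow, ha, inv_one]

theorem SemiInv.mul {m n : ℕ} {f g : Poly} (hf : SemiInv m f) (hg : SemiInv n g) :
    SemiInv (m + n) (f * g) := fun σ => by
  rw [map_mul, hf σ, hg σ, pow_add, C_mul]; ring

theorem SemiInv.pow {m : ℕ} {f : Poly} (hf : SemiInv m f) (k : ℕ) : SemiInv (m * k) (f ^ k) :=
  fun σ => by rw [map_pow, hf σ, mul_pow, ← C_pow, ← pow_mul]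

theorem SemiInv.congr {m n : ℕ} {f : Poly} (hf : SemiInv m f) (h : m % 4 = n % 4) :
    SemiInv n f := fun σ => by
  rw [hf σ, ← Nat.div_add_mod m 4, ← Nat.div_add_mod n 4, h]
  simp only [pow_add, pow_mul, rho3_pow_four, one_pow]

theorem SemiInv.of_mul {m n : ℕ} {f g : Poly} (hf0 : f ≠ 0) (hf : SemiInv m f)
    (hfg : SemiInv (m + n) (f * g)) : SemiInv n g := fun σ => by
  have h := hfg σ
  rw [map_mul, hf σ, pow_add, C_mul] at h
  have h0 : (C ((rho3 σ : ℂ) ^ m) * f : Poly) ≠ 0 :=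
    mul_ne_zero (by simp [(rho3 σ).ne_zero]) hf0
  refine mul_left_cancel₀ h0 ?_
  rw [h]; ring

/-- Used to carry one known linear divisor to its whole orbit under the group. -/
theorem SemiInv.dvd {m : ℕ} {f p : Poly} (hf : SemiInv m f) (σ : grp) (h : p ∣ f) :
    subst (σ : GL (Fin 2) ℂ) p ∣ f := by
  have h1 := map_dvd (subst (σ : GL (Fin 2) ℂ)) h
  rw [hf σ] at h1
  have hu : IsUnit (C ((rho3 σ : ℂ) ^ m) : Poly) := by
    rw [C_pow]
    exact ((rho3 σ).isUnit.map C).pow m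
  exact (hu.dvd_mul_left).1 h1

theorem semiInv_Gam : SemiInv 1 Gam := by
  have h := C_invSqrtTwo_sq
  have h2 : (C invSqrtTwo : Poly) ^ 6 * 8 = 1 := by
    calc _ = ((C invSqrtTwo : Poly) ^ 2 * 2) ^ 3 := by ring
      _ = 1 := by rw [h, one_pow]
  apply semiInv_of_gen
  · simp only [Gam, map_add, map_neg, map_mul, map_pow, subst_T_X0, subst_T_X1]
    linear_combination (-(X 0 ^ 5 * X 1) + X 0 * X 1 ^ 5 : Poly) * h2
  · have hI := C_I_sq
    simp only [Gam, map_add, map_neg, map_mul, map_pow, subst_D_X0, subst_D_X1, pow_one]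
    linear_combination (X 0 * X 1 ^ 5 * C Complex.I * (C Complex.I ^ 2 - 1) : Poly) * hI

/-- `Δ²` is invariant. -/
theorem semiInv_Del_sq : SemiInv 0 (Del ^ 2) := by
  have h := C_invSqrtTwo_sq
  have h2 : (C invSqrtTwo : Poly) ^ 12 * 64 = 1 := by
    calc _ = ((C invSqrtTwo : Poly) ^ 2 * 2) ^ 6 := by ring
      _ = 1 := by rw [h, one_pow]
  have hI := C_I_sq
  have hI4 : (C Complex.I : Poly) ^ 4 = 1 := by linear_combination (C Complex.I ^ 2 - 1 : Poly) * hI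
  apply semiInv_of_gen
  · have : subst matT Del = - Del := by
      simp only [Del, map_add, map_sub, map_mul, map_pow, map_ofNat, subst_T_X0, subst_T_X1]
      linear_combination
        (-(X 0 ^ 12 - 33 * X 0 ^ 8 * X 1 ^ 4 - 33 * X 0 ^ 4 * X 1 ^ 8 + X 1 ^ 12) : Poly) * h2
    rw [map_pow, this]; ring
  · have : subst matD Del = Del := by
      simp only [Del, map_add, map_sub, map_mul, map_pow, map_ofNat, subst_D_X0, subst_D_X1]
      rw [mul_pow, mul_pow, mul_pow, show 8 = 4 * 2 from rfl, show 12 = 4 * 3 from rfl,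
        pow_mul (C Complex.I), pow_mul (C Complex.I), hI4]
      ring
    rw [map_pow, this]; simp

/-- The invariant `x⁸ + 14x⁴y⁴ + y⁸`. -/
def W8 : Poly := X 0 ^ 8 + 14 * X 0 ^ 4 * X 1 ^ 4 + X 1 ^ 8

theorem semiInv_W8 : SemiInv 0 W8 := by
  have h2 : (C invSqrtTwo : Poly) ^ 8 * 16 = 1 := by
    calc _ = ((C invSqrtTwo : Poly) ^ 2 * 2) ^ 4 := by ring
      _ = 1 := by rw [C_invSqrtTwo_sq, one_pow]
  have hI := C_I_sq
  have hI4 : (C Complex.I : Poly) ^ 4 = 1 := by linear_combination (C Complex.I ^ 2 - 1 : Poly) * hI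
  apply semiInv_of_gen
  · simp only [W8, map_add, map_mul, map_pow, map_ofNat, subst_T_X0, subst_T_X1]
    linear_combination (X 0 ^ 8 + 14 * X 0 ^ 4 * X 1 ^ 4 + X 1 ^ 8 : Poly) * h2
  · simp only [W8, map_add, map_mul, map_pow, map_ofNat, subst_D_X0, subst_D_X1]
    rw [mul_pow, mul_pow, show 8 = 4 * 2 from rfl, pow_mul (C Complex.I), hI4]
    simp

/-! ### Homogeneity -/

theorem isHomogeneous_Gam : Gam.IsHomogeneous 6 :=
  ((isHomogeneous_X_pow 0 5).mul (isHomogeneous_X ℂ 1)).neg.add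
    ((isHomogeneous_X ℂ 0).mul (isHomogeneous_X_pow 1 5))

theorem isHomogeneous_ofNat (n : ℕ) [n.AtLeastTwo] :
    (OfNat.ofNat n : Poly).IsHomogeneous 0 := by
  rw [← map_ofNat (C : ℂ →+* Poly) n]; exact isHomogeneous_C _ _

theorem isHomogeneous_W8 : W8.IsHomogeneous 8 :=
  ((isHomogeneous_X_pow 0 8).add ((((isHomogeneous_ofNat 14).mul
    (isHomogeneous_X_pow 0 4))).mul (isHomogeneous_X_pow 1 4))).add (isHomogeneous_X_pow 1 8)

theorem isHomogeneous_Del : Del.IsHomogeneous 12 :=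
  (((isHomogeneous_X_pow 0 12).sub (((isHomogeneous_ofNat 33).mul
    (isHomogeneous_X_pow 0 8)).mul (isHomogeneous_X_pow 1 4))).sub
    (((isHomogeneous_ofNat 33).mul (isHomogeneous_X_pow 0 4)).mul (isHomogeneous_X_pow 1 8))).add
    (isHomogeneous_X_pow 1 12)

theorem Gam_ne_zero : Gam ≠ 0 := fun h => by
  have := congrArg (eval ![1, 2]) h
  simp [Gam] at this
  norm_num at this

theorem Del_ne_zero : Del ≠ 0 := fun h => by
  have := congrArg (eval ![1, 0]) h
  simp [Del] at this

/-! ### Divisibility by the reflecting lines -/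

/-- The binary form `x^k - a y^k`. -/
def binForm (k : ℕ) (a : ℂ) : Poly := X 0 ^ k - C a * X 1 ^ k

theorem isRelPrime_X : IsRelPrime (X 0 : Poly) (X 1) := by
  rw [(X_prime (i := (0 : Fin 2))).irreducible.isRelPrime_iff_not_dvd, X_dvd_X]
  decide

/-- A common divisor divides `(a - b)x^k` and `(a - b)y^k`, and `x^k`, `y^k` are coprime. -/
theorem isRelPrime_binForm {k : ℕ} {a b : ℂ} (h : a ≠ b) :
    IsRelPrime (binForm k a) (binForm k b) := by
  intro d ha hb
  have hu : IsUnit (C (a - b) : Poly) := (sub_ne_zero.2 h).isUnit.map C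
  refine (isRelPrime_X.pow (m := k) (n := k)) ?_ ?_
  · refine (hu.dvd_mul_left).1 ((dvd_sub (hb.mul_left (C a)) (ha.mul_left (C b))).trans
      (dvd_of_eq ?_))
    simp only [binForm, C_sub]; ring
  · refine (hu.dvd_mul_left).1 ((dvd_sub hb ha).trans (dvd_of_eq ?_))
    simp only [binForm, C_sub]; ring

theorem isRelPrime_X1_binForm {k : ℕ} (hk : k ≠ 0) (a : ℂ) :
    IsRelPrime (X 1) (binForm k a) := by
  intro d h1 ha
  have h1k : d ∣ X 1 ^ k := dvd_pow h1 hk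
  refine (isRelPrime_X.pow (m := k) (n := k)) ?_ h1k
  refine (dvd_add ha (h1k.mul_left (C a))).trans (dvd_of_eq ?_)
  simp only [binForm]; ring

theorem X0_pow_eq_binForm (k : ℕ) : (X 0 : Poly) ^ k = binForm k 0 := by
  simp [binForm]

theorem SemiInv.line_I {m n : ℕ} {f : Poly} (hf : SemiInv m f) {a : ℂ}
    (h : binForm 1 a ^ n ∣ f) : binForm 1 (a * Complex.I) ^ n ∣ f := by
  have := hf.dvd gD h
  rw [show ((gD : GL (Fin 2) ℂ) : Matrix (Fin 2) (Fin 2) ℂ) = matD from rfl, map_pow] at this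
  convert this using 2
  simp only [binForm, map_sub, map_mul, subst_C, subst_D_X0, subst_D_X1, pow_one]
  ring

/-- `D` rotates the slope `a` by `i`; as `a ≠ 0`, this gives four distinct lines, whose product is
`x⁴ - a⁴y⁴`. -/
theorem SemiInv.binForm_four {m n : ℕ} {f : Poly} (hf : SemiInv m f) {a : ℂ} (ha : a ≠ 0)
    (h : binForm 1 a ^ n ∣ f) : binForm 4 (a ^ 4) ^ n ∣ f := by
  have h1 := hf.line_I h
  have h2 := hf.line_I h1
  have h3 := hf.line_I h2
  rw [mul_assoc, Complex.I_mul_I, mul_neg_one] at h2 h3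
  have e : binForm 4 (a ^ 4) = (binForm 1 a * binForm 1 (-a)) *
      (binForm 1 (a * Complex.I) * binForm 1 (-a * Complex.I)) := by
    have hI := C_I_sq
    simp only [binForm, C_mul, C_neg, C_pow]
    linear_combination (X 1 ^ 2 * C a ^ 2 * X 0 ^ 2 - C a ^ 4 * X 1 ^ 4 : Poly) * hI
  have hI1 : (1 : ℂ) ≠ Complex.I := fun h => by simpa using congrArg Complex.im h
  have hI2 : (-1 : ℂ) ≠ Complex.I := fun h => by simpa using congrArg Complex.im h
  have h11 : (-1 : ℂ) ≠ 1 := by norm_num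
  have r : ∀ {u v : ℂ}, u ≠ v → IsRelPrime (binForm 1 (a * u)) (binForm 1 (a * v)) := fun huv =>
    isRelPrime_binForm fun h => huv (mul_left_cancel₀ ha h)
  have e1 : binForm 1 a = binForm 1 (a * 1) := by rw [mul_one]
  have e2 : binForm 1 (-a) = binForm 1 (a * -1) := by rw [mul_neg_one]
  have e3 : binForm 1 (-a * Complex.I) = binForm 1 (a * -Complex.I) := by
    rw [neg_mul, mul_neg]
  have n1 : (1 : ℂ) ≠ -Complex.I := fun h => hI2 (by rw [h, neg_neg])
  have n2 : (-1 : ℂ) ≠ -Complex.I := fun h => hI1 (neg_injective h)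
  have n3 : Complex.I ≠ -Complex.I := fun h => by
    have := congrArg Complex.im h
    simp at this
    norm_num at this
  rw [e1] at h
  rw [e2] at h2
  rw [← neg_mul, e3] at h3
  rw [e, e1, e2, e3, mul_pow, mul_pow, mul_pow]
  refine IsRelPrime.mul_dvd ?_ (IsRelPrime.mul_dvd (r h11.symm).pow h h2)
    (IsRelPrime.mul_dvd (r n3).pow h1 h3)
  exact IsRelPrime.mul_left (IsRelPrime.mul_right (r hI1).pow (r n1).pow)
    (IsRelPrime.mul_right (r hI2).pow (r n2).pow)

/-- `T` acts on slopes by `a ↦ (a + 1)/(a - 1)`; the hypothesis is this relation with the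
denominator cleared. -/
theorem SemiInv.line_T {m n : ℕ} {f : Poly} (hf : SemiInv m f) {a b : ℂ}
    (hb : b * (a - 1) = a + 1) (h : binForm 1 a ^ n ∣ f) : binForm 1 b ^ n ∣ f := by
  have := hf.dvd gT h
  rw [show ((gT : GL (Fin 2) ℂ) : Matrix (Fin 2) (Fin 2) ℂ) = matT from rfl, map_pow] at this
  have e : subst matT (binForm 1 a) = C (invSqrtTwo * (1 - a)) * binForm 1 b := by
    have hb' : (C b * (C a - 1) : Poly) = C a + 1 := by
      rw [← C_1, ← C_sub, ← C_mul, hb, C_add]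
    simp only [binForm, map_sub, map_mul, subst_C, subst_T_X0, subst_T_X1, pow_one, C_1]
    linear_combination (-C invSqrtTwo * X 1 : Poly) * hb'
  rw [e, mul_pow] at this
  exact dvd_of_mul_left_dvd this

theorem Gam_eq : Gam = -(X 0 * X 1 * binForm 4 1) := by
  simp only [Gam, binForm, C_1]; ring

/-- A semi-invariant that is divisible by `y^n` is divisible by `Γ^n`. -/
theorem SemiInv.Gam_pow_dvd {m n : ℕ} {f : Poly} (hf : SemiInv m f) (h : X 1 ^ n ∣ f) :
    Gam ^ n ∣ f := by
  -- The orbit of `y` is walked through: `T` gives `x - y`, powers of `D` give all of `x⁴ - y⁴`, and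
  -- `T` applied to `x + y` gives `x`.
  have h1 : binForm 1 1 ^ n ∣ f := by
    have := hf.dvd gT h
    rw [show ((gT : GL (Fin 2) ℂ) : Matrix (Fin 2) (Fin 2) ℂ) = matT from rfl, map_pow,
      subst_T_X1, mul_pow] at this
    convert dvd_of_mul_left_dvd this using 2
    simp [binForm]
  have h4 := hf.binForm_four one_ne_zero h1
  have hm : binForm 1 (-1) ^ n ∣ f := by
    have := hf.line_I (hf.line_I h1)
    rwa [mul_assoc, Complex.I_mul_I, one_mul] at this
  have h0 : binForm 1 0 ^ n ∣ f := hf.line_T (a := -1) (by norm_num) hm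
  rw [← X0_pow_eq_binForm, pow_one] at h0
  rw [one_pow] at h4
  have r0 : IsRelPrime (X 0) (binForm 4 1) := by
    have := (isRelPrime_binForm (k := 4) (zero_ne_one (α := ℂ)))
    rw [← X0_pow_eq_binForm] at this
    exact (IsRelPrime.pow_left_iff (by norm_num)).1 this
  rw [Gam_eq, neg_pow, mul_pow, mul_pow]
  refine (((isUnit_one.neg).pow n).mul_left_dvd).2 ?_
  exact IsRelPrime.mul_dvd (IsRelPrime.mul_left r0.pow
    (isRelPrime_X1_binForm (by norm_num) 1).pow) (IsRelPrime.mul_dvd isRelPrime_X.pow h0 h) h4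

/-- A semi-invariant that is divisible by the square of the reflecting line of `T` is divisible
by `Δ²`. -/
theorem SemiInv.Del_sq_dvd {m : ℕ} {f : Poly} (hf : SemiInv m f)
    (h : binForm 1 (1 + ((Real.sqrt 2 : ℝ) : ℂ)) ^ 2 ∣ f) : Del ^ 2 ∣ f := by
  have hs := sqrtTwo_mul_self
  have hs0 := sqrtTwo_ne_zero
  set s : ℂ := ((Real.sqrt 2 : ℝ) : ℂ)
  have ha : 1 + s ≠ 0 := fun h => by
    have h1 : s = -1 := by linear_combination h
    rw [h1] at hs; norm_num at hs
  have hb : 1 - s ≠ 0 := fun h => by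
    have h1 : s = 1 := by linear_combination -h
    rw [h1] at hs; norm_num at hs
  have h1 := hf.binForm_four ha h
  have hI := hf.line_I h
  have hm := hf.line_I hI
  rw [mul_assoc, Complex.I_mul_I, mul_neg_one] at hm
  have h2 : binForm 1 (-(1 - s)) ^ 2 ∣ f := by
    refine hf.line_T (a := -(1 + s)) ?_ hm
    linear_combination -hs
  have h2' := hf.binForm_four (neg_ne_zero.2 hb) h2
  have hc1 : (1 + s) * Complex.I - 1 ≠ 0 := fun h => by
    have h3 : (1 + s) ^ 2 = -1 := by
      linear_combination (-1 - (1 + s) * Complex.I) * h + (1 + s) ^ 2 * Complex.I_sq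
    have h4 : s = -2 := by linear_combination (h3 - hs) / 2
    rw [h4] at hs; norm_num at hs
  -- The image under `T` of the slope `(1 + √2)i`. Its fourth power is `-1`, so it supplies the
  -- factor `x⁴ + y⁴`.
  set c : ℂ := ((1 + s) * Complex.I + 1) / ((1 + s) * Complex.I - 1) with hc
  have hcm : c * ((1 + s) * Complex.I - 1) = (1 + s) * Complex.I + 1 := by
    rw [hc]; field_simp
  have h3 := hf.line_T hcm hI
  have hc4 : c ^ 4 = -1 := by
    have hI2 := Complex.I_sq
    rw [hc, div_pow, div_eq_iff (pow_ne_zero _ hc1)]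
    linear_combination (12 * (1 + s) ^ 2 + 2 * (1 + s) ^ 4 * (Complex.I ^ 2 - 1)) * hI2 +
      2 * (s ^ 2 + 4 * s + 2) * hs
  have hc0 : c ≠ 0 := fun h => by rw [h] at hc4; norm_num at hc4
  have h3' := hf.binForm_four hc0 h3
  have e1 : (1 + s) ^ 4 = 17 + 12 * s := by
    linear_combination (s ^ 2 + 4 * s + 8) * hs
  have e2 : (-(1 - s)) ^ 4 = 17 - 12 * s := by
    linear_combination (s ^ 2 - 4 * s + 8) * hs
  rw [e1] at h1
  rw [e2] at h2'
  rw [hc4] at h3'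
  -- `Δ = (x⁸ - 34x⁴y⁴ + y⁸)(x⁴ + y⁴)`, and `17 ± 12√2 = (1 ± √2)⁴` are the roots of `z² - 34z + 1`.
  have e : Del = binForm 4 (17 + 12 * s) * binForm 4 (17 - 12 * s) * binForm 4 (-1) := by
    have hs' : (C s * C s : Poly) = 2 := by rw [← C_mul, hs, map_ofNat]
    simp only [Del, binForm, C_add, C_sub, C_mul, C_neg, C_1, map_ofNat]
    linear_combination (144 * X 1 ^ 8 * (X 0 ^ 4 + X 1 ^ 4)) * hs'
  have ne1 : 17 + 12 * s ≠ -1 := fun h => by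
    have h1 : s = -3 / 2 := by linear_combination h / 12
    rw [h1] at hs; norm_num at hs
  have ne2 : 17 - 12 * s ≠ -1 := fun h => by
    have h1 : s = 3 / 2 := by linear_combination -h / 12
    rw [h1] at hs; norm_num at hs
  have ne3 : 17 + 12 * s ≠ 17 - 12 * s := fun h => by
    exact hs0 (by linear_combination h / 24)
  rw [e, mul_pow, mul_pow]
  exact IsRelPrime.mul_dvd (IsRelPrime.mul_left (isRelPrime_binForm ne1).pow
    (isRelPrime_binForm ne2).pow) (IsRelPrime.mul_dvd (isRelPrime_binForm ne3).pow h1 h2') h3'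

theorem isRelPrime_Gam_Del : IsRelPrime Gam Del := by
  have hu : IsUnit (C (-64) : Poly) := (by norm_num : (-64 : ℂ) ≠ 0).isUnit.map C
  have e : (C (-64) : Poly) = -64 := by rw [C_neg, map_ofNat]
  rw [Gam_eq, IsRelPrime.neg_left_iff]
  refine IsRelPrime.mul_left (IsRelPrime.mul_left ?_ ?_) ?_
  · intro d h0 h
    refine (isRelPrime_X.pow_right (n := 12)) h0 ?_
    refine (dvd_sub h (h0.mul_right (X 0 ^ 11 - 33 * X 0 ^ 7 * X 1 ^ 4 -
      33 * X 0 ^ 3 * X 1 ^ 8))).trans (dvd_of_eq ?_)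
    simp only [Del]; ring
  · intro d h1 h
    refine (isRelPrime_X.pow_left (m := 12)) ?_ h1
    refine (dvd_sub h (h1.mul_right (X 1 ^ 11 - 33 * X 1 ^ 7 * X 0 ^ 4 -
      33 * X 1 ^ 3 * X 0 ^ 8))).trans (dvd_of_eq ?_)
    simp only [Del]; ring
  -- Modulo `x⁴ - y⁴`, `Δ` is congruent both to `-64x¹²` and to `-64y¹²`; the multipliers are the
  -- quotients.
  · intro d hb h
    refine (isRelPrime_X.pow (m := 12) (n := 12)) ?_ ?_
    · refine (hu.dvd_mul_left).1 ((dvd_sub h (hb.mul_right (65 * X 0 ^ 8 +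
        32 * X 0 ^ 4 * X 1 ^ 4 - X 1 ^ 8))).trans (dvd_of_eq ?_))
      rw [e]; simp only [Del, binForm, C_1]; ring
    · refine (hu.dvd_mul_left).1 ((dvd_sub h (hb.mul_right (X 0 ^ 8 -
        32 * X 0 ^ 4 * X 1 ^ 4 - 65 * X 1 ^ 8))).trans (dvd_of_eq ?_))
      rw [e]; simp only [Del, binForm, C_1]; ring

/-! ### Divisibility by powers of `y` -/

theorem X1_pow_dvd {f : Poly} {k : ℕ} (h : ∀ d, coeff d f ≠ 0 → k ≤ d 1) :
    (X 1 : Poly) ^ k ∣ f := by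
  rw [f.as_sum]
  refine Finset.dvd_sum fun d hd => ?_
  rw [X_pow_eq_monomial, monomial_dvd_monomial]
  refine ⟨Or.inr ?_, one_dvd _⟩
  simpa using h d (mem_support_iff.1 hd)

theorem coeff_subst_diagonal (v : Fin 2 → ℂ) (f : Poly) (d : Fin 2 →₀ ℕ) :
    coeff d (subst (Matrix.diagonal v) f) = v 0 ^ d 0 * v 1 ^ d 1 * coeff d f := by
  induction f using MvPolynomial.induction_on' with
  | monomial e a =>
    have : subst (Matrix.diagonal v) (monomial e a) =
        C (v 0 ^ e 0 * v 1 ^ e 1) * monomial e a := by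
      rw [monomial_eq, map_mul, subst_C, Finsupp.prod_fintype _ _ (by simp), map_prod]
      simp only [Fin.prod_univ_two, map_pow, subst_X, Fin.sum_univ_two, Matrix.diagonal_apply_eq,
        Matrix.diagonal_apply_ne _ (zero_ne_one' (Fin 2)),
        Matrix.diagonal_apply_ne _ (zero_ne_one' (Fin 2)).symm, C_0, C_mul]
      ring
    rw [this, coeff_C_mul, coeff_monomial]
    split_ifs with h
    · rw [h]
    · simp
  | add p q hp hq => rw [map_add, coeff_add, hp, hq, coeff_add, mul_add]

theorem coeff_subst_D (f : Poly) (d : Fin 2 →₀ ℕ) :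
    coeff d (subst matD f) = Complex.I ^ d 1 * coeff d f := by
  have : matD = Matrix.diagonal ![1, Complex.I] := by
    ext i j
    fin_cases i <;> fin_cases j <;> simp [matD]
  rw [this, coeff_subst_diagonal]
  simp

theorem I_pow_inj {a b : ℕ} (h : Complex.I ^ a = Complex.I ^ b) : a % 4 = b % 4 := by
  have r : ∀ a : ℕ, Complex.I ^ a = Complex.I ^ (a % 4) := fun a => by
    conv_lhs => rw [← Nat.div_add_mod a 4, pow_add, pow_mul, Complex.I_pow_four, one_pow, one_mul]
  rw [r a, r b] at h
  have ha := Nat.mod_lt a (by norm_num : 0 < 4)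
  have hb := Nat.mod_lt b (by norm_num : 0 < 4)
  generalize a % 4 = u at *
  generalize b % 4 = v at *
  interval_cases u <;> interval_cases v <;>
    first
      | rfl
      | (exfalso; simp [pow_succ, Complex.ext_iff] at h <;> norm_num at h)

/-- `D` multiplies `x^p y^q` by `i^q`, so only exponents `q` congruent to `m` modulo `4` occur. -/
theorem X1_pow_dvd_of_subst_D {f : Poly} {m : ℕ}
    (h : subst matD f = C (Complex.I ^ m) * f) : (X 1 : Poly) ^ (m % 4) ∣ f := by
  refine X1_pow_dvd fun d hd => ?_
  have h1 := congrArg (coeff d) h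
  rw [coeff_subst_D, coeff_C_mul] at h1
  rw [← I_pow_inj (mul_right_cancel₀ hd h1)]
  exact Nat.mod_le _ _

/-! ### Covariants of the four representations -/

/-- The exponent `m` with `ρ_{29+j} = ρ₃^m ⊗ ρ₂₉`. -/
def twistExp (j : Fin 4) : ℕ := ![0, 2, 1, 3] j

theorem coe_rho (j : Fin 4) (σ : grp) : (rho j σ : Matrix (Fin 4) (Fin 4) ℂ) =
    (rho3 σ : ℂ) ^ twistExp j • symCube (σ : GL (Fin 2) ℂ) := by
  fin_cases j
  · simp [rho, twistExp, rho29]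
  · simp [rho, twistExp, coe_twist, rho2]; rfl
  · simp [rho, twistExp, coe_twist]; rfl
  · simp [rho, twistExp, coe_twist, rho4]; rfl

theorem rho_T (j : Fin 4) : (rho j gT : Matrix (Fin 4) (Fin 4) ℂ) =
    (2 * ((Real.sqrt 2 : ℝ) : ℂ))⁻¹ •
      !![1, 3, 3, 1; 1, 1, -1, -1; 1, -1, -1, 1; 1, -3, 3, -1] := by
  rw [coe_rho, rho3_T, one_pow, one_smul]; exact rho29_T

theorem rho_D (j : Fin 4) : (rho j gD : Matrix (Fin 4) (Fin 4) ℂ) =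
    Matrix.diagonal fun r : Fin 4 => Complex.I ^ (twistExp j + (r : ℕ)) := by
  rw [coe_rho, rho3_D, show symCube ((gD : GL (Fin 2) ℂ) : Matrix _ _ ℂ) = _ from rho29_D]
  ext r s
  by_cases h : r = s
  · subst h
    rw [Matrix.smul_apply, Matrix.diagonal_apply_eq, Matrix.diagonal_apply_eq, pow_add,
      smul_eq_mul]
    congr 1
    fin_cases r <;> simp
  · rw [Matrix.smul_apply, Matrix.diagonal_apply_ne _ h, Matrix.diagonal_apply_ne _ h, smul_zero]

theorem mem_covariants_of_gen {m : ℕ} {ρ : grp →* GL (Fin m) ℂ} {F : Fin m → Poly}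
    (hT : ∀ r, subst matT (F r) = ∑ s, C ((ρ gT : Matrix (Fin m) (Fin m) ℂ) r s) * F s)
    (hD : ∀ r, subst matD (F r) = ∑ s, C ((ρ gD : Matrix (Fin m) (Fin m) ℂ) r s) * F s) :
    F ∈ covariants ρ := by
  refine fun σ => grp_induction (p := fun σ : grp => ∀ r,
    subst (σ : GL (Fin 2) ℂ) (F r) = ∑ s, C ((ρ σ : Matrix (Fin m) (Fin m) ℂ) r s) * F s)
    hT hD ?_ ?_ ?_ σ
  · intro r
    simp [subst_one, Matrix.one_apply]
  · intro a b ha hb r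
    rw [Subgroup.coe_mul, Units.val_mul, subst_mul, ha, map_sum, map_mul, Units.val_mul]
    simp only [map_mul, subst_C, hb, Finset.mul_sum, Matrix.mul_apply, map_sum, Finset.sum_mul]
    rw [Finset.sum_comm]
    simp only [mul_assoc]
  · intro a ha r
    have h : ∀ s, F s = ∑ t, C ((ρ a : Matrix (Fin m) (Fin m) ℂ) s t) *
        subst ((a⁻¹ : grp) : GL (Fin 2) ℂ) (F t) := fun s => by
      have h := congrArg (subst ((a⁻¹ : grp) : GL (Fin 2) ℂ)) (ha s)
      rw [← subst_mul, ← Units.val_mul, ← Subgroup.coe_mul, mul_inv_cancel, map_sum,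
        OneMemClass.coe_one, Units.val_one, subst_one] at h
      simpa only [map_mul, subst_C] using h
    have h2 : ((ρ a⁻¹ : GL (Fin m) ℂ) : Matrix (Fin m) (Fin m) ℂ) *
        (ρ a : Matrix (Fin m) (Fin m) ℂ) = 1 := by
      rw [← Units.val_mul, ← map_mul, inv_mul_cancel, map_one, Units.val_one]
    calc _ = ∑ t, C ((1 : Matrix (Fin m) (Fin m) ℂ) r t) *
          subst ((a⁻¹ : grp) : GL (Fin 2) ℂ) (F t) := by simp [Matrix.one_apply]
      _ = _ := by
        rw [← h2]
        simp only [Matrix.mul_apply, map_sum, map_mul, Finset.sum_mul]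
        rw [Finset.sum_comm]
        refine Finset.sum_congr rfl fun s _ => ?_
        rw [h s, Finset.mul_sum]
        simp only [mul_assoc]

/-- The matrix with the given columns. -/
def colMat (F : Fin 4 → Fin 4 → Poly) : Matrix (Fin 4) (Fin 4) Poly := Matrix.of fun r k => F k r

theorem subst_det_colMat {j : Fin 4} {F : Fin 4 → Fin 4 → Poly}
    (hF : ∀ k, F k ∈ covariants (rho j)) (σ : grp) :
    subst (σ : GL (Fin 2) ℂ) (colMat F).det =
      C (rho j σ : Matrix (Fin 4) (Fin 4) ℂ).det * (colMat F).det := by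
  rw [AlgHom.map_det, RingHom.map_det, ← Matrix.det_mul]
  congr 1
  refine Matrix.ext fun r k => ?_
  rw [Matrix.mul_apply]
  exact hF k σ r

theorem det_rho_T (j : Fin 4) : (rho j gT : Matrix (Fin 4) (Fin 4) ℂ).det = 1 := by
  have h := invSqrtTwo_sq
  have h4 : invSqrtTwo ^ 4 = 1 / 4 := by
    linear_combination (invSqrtTwo ^ 2 + 1 / 2) * h
  rw [rho_T, Matrix.det_smul, mul_inv, mul_pow]
  change _ * invSqrtTwo ^ 4 * _ = _
  rw [h4]
  simp [Matrix.det_succ_row_zero, Fin.sum_univ_succ, Fin.succAbove]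
  norm_num

theorem det_rho_D (j : Fin 4) : (rho j gD : Matrix (Fin 4) (Fin 4) ℂ).det = Complex.I ^ 2 := by
  rw [rho_D, Matrix.det_diagonal, Fin.prod_univ_four]
  simp only [← pow_add]
  have := Complex.I_pow_four
  rw [show twistExp j + ((0 : Fin 4) : ℕ) + (twistExp j + ((1 : Fin 4) : ℕ)) +
    (twistExp j + ((2 : Fin 4) : ℕ)) + (twistExp j + ((3 : Fin 4) : ℕ)) =
    4 * (twistExp j + 1) + 2 by simp; ring, pow_add, pow_mul, this, one_pow, one_mul]

/-- Twisting a four-dimensional representation by `ρ₃` changes its determinant by `ρ₃⁴ = 1`, so the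
weight is the same in all four cases. -/
theorem semiInv_det_colMat {j : Fin 4} {F : Fin 4 → Fin 4 → Poly}
    (hF : ∀ k, F k ∈ covariants (rho j)) : SemiInv 2 (colMat F).det := by
  refine semiInv_of_gen ((subst_det_colMat hF gT).trans ?_) ((subst_det_colMat hF gD).trans ?_)
  · rw [det_rho_T, C_1, one_mul]
  · rw [det_rho_D]

theorem det_diagonal_dvd {M : Matrix (Fin 4) (Fin 4) Poly} {p : Fin 4 → Poly}
    (h : ∀ r k, p r ∣ M r k) : ∏ r, p r ∣ M.det := by
  choose N hN using h
  have : M = Matrix.diagonal p * Matrix.of N := by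
    ext1 r k
    rw [Matrix.diagonal_mul, hN, Matrix.of_apply]
  rw [this, Matrix.det_mul, Matrix.det_diagonal]
  exact Dvd.intro _ rfl

/-- For every twist the residues of `m + r` modulo `4` run over `0, 1, 2, 3`, with sum `6`. -/
theorem X1_pow_six_dvd_det {j : Fin 4} {F : Fin 4 → Fin 4 → Poly}
    (hF : ∀ k, F k ∈ covariants (rho j)) : X 1 ^ 6 ∣ (colMat F).det := by
  have h : ∀ r k : Fin 4, (X 1 : Poly) ^ ((twistExp j + (r : ℕ)) % 4) ∣ colMat F r k := fun r k => by
    refine X1_pow_dvd_of_subst_D ((hF k gD r).trans ?_)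
    rw [rho_D, Finset.sum_eq_single r]
    · rw [Matrix.diagonal_apply_eq]; rfl
    · intro s _ hs
      rw [Matrix.diagonal_apply_ne' _ hs, C_0, zero_mul]
    · simp
  have := det_diagonal_dvd h
  rw [Finset.prod_pow_eq_pow_sum] at this
  convert this using 2
  fin_cases j <;> rfl

/-- `T` fixes the line `x = (1 + √2)y` pointwise. Algebraically, `subst matT` and the identity agree
on `x` and `y` modulo the linear form, hence everywhere. -/
theorem line_dvd_subst_T_sub (f : Poly) :
    binForm 1 (1 + ((Real.sqrt 2 : ℝ) : ℂ)) ∣ subst matT f - f := by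
  have hs := sqrtTwo_mul_self
  have hi : invSqrtTwo * ((Real.sqrt 2 : ℝ) : ℂ) = 1 := inv_mul_cancel₀ sqrtTwo_ne_zero
  set s : ℂ := ((Real.sqrt 2 : ℝ) : ℂ)
  set I : Ideal Poly := Ideal.span {binForm 1 (1 + s)}
  have hi' : (C invSqrtTwo * C s : Poly) = 1 := by rw [← C_mul, hi, C_1]
  have hs' : (C s * C s : Poly) = 2 := by rw [← C_mul, hs, map_ofNat]
  have h : (Ideal.Quotient.mkₐ ℂ I).comp (subst matT) = Ideal.Quotient.mkₐ ℂ I := by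
    refine MvPolynomial.algHom_ext fun i => ?_
    rw [AlgHom.comp_apply, Ideal.Quotient.mkₐ_eq_mk, Ideal.Quotient.eq, Ideal.mem_span_singleton]
    fin_cases i
    · refine ⟨C (invSqrtTwo - 1), ?_⟩
      simp only [Fin.zero_eta, subst_T_X0, binForm, C_sub, C_add, C_1, pow_one]
      linear_combination (X 1 * (1 + C s) : Poly) * hi' - X 1 * C invSqrtTwo * hs'
    · refine ⟨C invSqrtTwo, ?_⟩
      simp only [Fin.mk_one, subst_T_X1, binForm, C_add, C_1, pow_one]
      linear_combination (X 1 : Poly) * hi'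
  have h1 := DFunLike.congr_fun h f
  rwa [AlgHom.comp_apply, Ideal.Quotient.mkₐ_eq_mk, Ideal.Quotient.eq,
    Ideal.mem_span_singleton] at h1

theorem line_sq_dvd_det {j : Fin 4} {F : Fin 4 → Fin 4 → Poly}
    (hF : ∀ k, F k ∈ covariants (rho j)) :
    binForm 1 (1 + ((Real.sqrt 2 : ℝ) : ℂ)) ^ 2 ∣ (colMat F).det := by
  set l := binForm 1 (1 + ((Real.sqrt 2 : ℝ) : ℂ))
  set A : Matrix (Fin 4) (Fin 4) ℂ := (rho j gT : Matrix (Fin 4) (Fin 4) ℂ) - 1 with hA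
  -- The first two rows of `ρ(T) - 1` are independent in the last two columns, so two unit rows
  -- complete them to an invertible `P`. In `P * colMat F` the last two rows are `F ∘ T - F`, both
  -- divisible by the line.
  let P : Matrix (Fin 4) (Fin 4) ℂ := Matrix.of ![![1, 0, 0, 0], ![0, 1, 0, 0], A 0, A 1]
  have hP : P.det = -1 / 4 := by
    have h := invSqrtTwo_sq
    have e : P.det = A 0 2 * A 1 3 - A 0 3 * A 1 2 := by
      simp [P, Matrix.det_succ_row_zero, Fin.sum_univ_succ, Fin.succAbove]
      ring
    rw [e, hA, rho_T, mul_inv]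
    change (2⁻¹ * invSqrtTwo * 3 - 0) * (2⁻¹ * invSqrtTwo * -1 - 0) -
      (2⁻¹ * invSqrtTwo * 1 - 0) * (2⁻¹ * invSqrtTwo * -1 - 0) = _
    linear_combination (-1 / 2) * h
  have hrow : ∀ r k, l ∣ ∑ s, C (A r s) * F k s := fun r k => by
    have e : ∑ s, C (A r s) * F k s = subst matT (F k r) - F k r := by
      rw [show subst matT (F k r) = _ from hF k gT r, hA]
      simp only [Matrix.sub_apply, C_sub, sub_mul, Finset.sum_sub_distrib]
      congr 1
      rw [Finset.sum_eq_single r]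
      · simp
      · intro s _ hs
        simp [Matrix.one_apply_ne' hs]
      · simp
    rw [e]
    exact line_dvd_subst_T_sub _
  have h : ∀ r k, ![1, 1, l, l] r ∣ ((C : ℂ →+* Poly).mapMatrix P * colMat F) r k := by
    intro r k
    fin_cases r
    · exact one_dvd _
    · exact one_dvd _
    · exact hrow 0 k
    · exact hrow 1 k
  have h2 := det_diagonal_dvd h
  rw [Matrix.det_mul, ← RingHom.map_det, hP, Fin.prod_univ_four] at h2
  have hu : IsUnit (C (-1 / 4) : Poly) := (by norm_num : (-1 / 4 : ℂ) ≠ 0).isUnit.map C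
  refine (dvd_of_eq ?_).trans ((hu.dvd_mul_left).1 h2)
  simp [sq]

theorem Del_sq_mul_Gam_pow_ne_zero : Del ^ 2 * Gam ^ 6 ≠ 0 :=
  mul_ne_zero (pow_ne_zero _ Del_ne_zero) (pow_ne_zero _ Gam_ne_zero)

/-- The determinant of four covariants is an invariant multiple of `Δ²Γ⁶`. -/
theorem exists_det_colMat_eq {j : Fin 4} {F : Fin 4 → Fin 4 → Poly}
    (hF : ∀ k, F k ∈ covariants (rho j)) :
    ∃ q : invRing, (colMat F).det = q * (Del ^ 2 * Gam ^ 6) := by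
  have h := semiInv_det_colMat hF
  obtain ⟨q, hq⟩ := (isRelPrime_Gam_Del.symm.pow (m := 2) (n := 6)).mul_dvd
    (h.Del_sq_dvd (line_sq_dvd_det hF)) (h.Gam_pow_dvd (X1_pow_six_dvd_det hF))
  refine ⟨⟨q, semiInv_zero_iff.1 ?_⟩, by rw [hq, mul_comm]⟩
  have h6 : SemiInv 2 (Del ^ 2 * Gam ^ 6) :=
    (semiInv_Del_sq.mul (semiInv_Gam.pow 6)).congr (by norm_num)
  rw [hq] at h
  exact SemiInv.of_mul Del_sq_mul_Gam_pow_ne_zero h6 h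

/-! ### The basis criterion -/

local instance (j : Fin 4) : AddCommGroup (covariants (rho j)) := inferInstance

local instance (j : Fin 4) : Module invRing (covariants (rho j)) := (covariants (rho j)).module

local instance (j : Fin 4) : SMul invRing (covariants (rho j)) :=
  (covariants (rho j)).module.toDistribMulAction.toMulAction.toSMul

theorem coe_sum_smul {j : Fin 4} (a : Fin 4 → invRing) (F : Fin 4 → covariants (rho j))
    (r : Fin 4) : (∑ k, a k • F k : covariants (rho j)).1 r =
      ∑ k, (a k : Poly) * (F k).1 r := by
  rw [AddSubmonoidClass.coe_finsetSum, Finset.sum_apply]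
  rfl

/-- Four covariants whose determinant is a nonzero multiple of `Δ²Γ⁶` form a basis. -/
theorem exists_basis_of_det {j : Fin 4} {c : ℂ} (hc : c ≠ 0) (F : Fin 4 → covariants (rho j))
    (h : colDet F = C c * (Del ^ 2 * Gam ^ 6)) :
    ∃ w : Module.Basis (Fin 4) invRing (covariants (rho j)), ∀ k, w k = F k := by
  have hC : (C c : Poly) ≠ 0 := by simpa using hc
  have hdet : (colMat fun k => (F k : Fin 4 → Poly)).det = C c * (Del ^ 2 * Gam ^ 6) := h
  have hne : (colMat fun k => (F k : Fin 4 → Poly)).det ≠ 0 := by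
    rw [hdet]; exact mul_ne_zero hC Del_sq_mul_Gam_pow_ne_zero
  have hli : LinearIndependent invRing F := by
    rw [Fintype.linearIndependent_iff]
    intro a ha
    have h0 : (colMat fun k => (F k : Fin 4 → Poly)).mulVec (fun k => (a k : Poly)) = 0 := by
      funext r
      have := coe_sum_smul a F r
      rw [ha] at this
      simp only [Matrix.mulVec, dotProduct, colMat, Matrix.of_apply, Pi.zero_apply]
      rw [show (0 : covariants (rho j)).1 r = 0 from rfl] at this
      rw [this]
      exact Finset.sum_congr rfl fun _ _ => mul_comm _ _
    have := Matrix.eq_zero_of_mulVec_eq_zero hne h0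
    exact fun k => Subtype.ext (congrFun this k)
  have hsp : ⊤ ≤ Submodule.span invRing (Set.range F) := by
    intro G _
    -- The numerators in Cramer's rule are again determinants of four covariants, so dividing by
    -- `cΔ²Γ⁶` leaves an invariant.
    have hupd : ∀ k, ∃ q : invRing, (colMat (Function.update
        (fun k => (F k : Fin 4 → Poly)) k G)).det = q * (Del ^ 2 * Gam ^ 6) := fun k => by
      refine exists_det_colMat_eq (j := j) fun l => ?_
      rcases eq_or_ne l k with rfl | hl
      · rw [Function.update_self]; exact G.2
      · rw [Function.update_of_ne hl]; exact (F l).2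
    choose q hq using hupd
    have hcr : (colMat fun k => (F k : Fin 4 → Poly)).cramer G.1 =
        fun k => (q k : Poly) * (Del ^ 2 * Gam ^ 6) := by
      funext k
      rw [Matrix.cramer_apply, ← hq k]
      congr 1
      ext1 r l
      simp only [colMat, Matrix.updateCol_apply, Matrix.of_apply, Function.update_apply]
      split_ifs <;> rfl
    have key := Matrix.mulVec_cramer (colMat fun k => (F k : Fin 4 → Poly)) G.1
    rw [hcr, hdet] at key
    have hG : G = ∑ k, (algebraMap ℂ invRing c⁻¹ * q k) • F k := by
      refine Subtype.ext (funext fun r => ?_)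
      rw [coe_sum_smul]
      have kr := congrFun key r
      simp only [Matrix.mulVec, dotProduct, colMat, Matrix.of_apply, Pi.smul_apply,
        smul_eq_mul] at kr
      refine mul_left_cancel₀ (mul_ne_zero hC Del_sq_mul_Gam_pow_ne_zero) ?_
      rw [← kr, Finset.mul_sum]
      refine Finset.sum_congr rfl fun k _ => ?_
      have hcc : (C c * C c⁻¹ : Poly) = 1 := by rw [← C_mul, mul_inv_cancel₀ hc, C_1]
      rw [show ((algebraMap ℂ invRing c⁻¹ * q k : invRing) : Poly) = C c⁻¹ * (q k : Poly) from rfl]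
      linear_combination (-(F k).1 r * (q k : Poly) * (Del ^ 2 * Gam ^ 6)) * hcc
    rw [hG]
    exact Submodule.sum_mem _ fun k _ => Submodule.smul_mem _ _ (Submodule.subset_span ⟨k, rfl⟩)
  exact ⟨Module.Basis.mk hli hsp, fun k => by rw [Module.Basis.mk_apply]⟩

/-- The determinant of any basis is a nonzero multiple of that of any other. -/
theorem colDet_basis {j : Fin 4} {c : ℂ} (hc : c ≠ 0)
    (w₀ w : Module.Basis (Fin 4) invRing (covariants (rho j)))
    (h : colDet w₀ = C c * (Del ^ 2 * Gam ^ 6)) :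
    ∃ c' : ℂ, c' ≠ 0 ∧ colDet w = C c' * (Del ^ 2 * Gam ^ 6) := by
  obtain ⟨q, hq⟩ := exists_det_colMat_eq (fun k => (w k).2)
  have hmul : colMat (fun k => (w₀ k : Fin 4 → Poly)) = colMat (fun k => (w k : Fin 4 → Poly)) *
      Matrix.of fun l k => (w.repr (w₀ k) l : Poly) := by
    ext1 r k
    simp only [Matrix.mul_apply, colMat, Matrix.of_apply]
    conv_lhs => rw [← w.sum_repr (w₀ k)]
    rw [coe_sum_smul]
    exact Finset.sum_congr rfl fun _ _ => mul_comm _ _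
  have hdet := congrArg Matrix.det hmul
  rw [Matrix.det_mul, hq, show (colMat fun k => (w₀ k : Fin 4 → Poly)).det = _ from h] at hdet
  -- After cancelling `Δ²Γ⁶`, `q` divides a nonzero constant and is therefore itself one.
  have hu : (q : Poly) * (Matrix.of fun l k => (w.repr (w₀ k) l : Poly)).det = C c := by
    refine mul_right_cancel₀ Del_sq_mul_Gam_pow_ne_zero ?_
    rw [hdet]; ring
  have hq' : IsUnit (q : Poly) := isUnit_of_dvd_unit ⟨_, hu.symm⟩ (hc.isUnit.map C)
  obtain ⟨c', hc', e⟩ := isUnit_iff_eq_C_of_isReduced.1 hq'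
  exact ⟨c', hc'.ne_zero, by rw [← e]; exact hq⟩

/-! ### The symmetry under `τ` -/

/-- The transposition of the coordinates, as an element of `𝔊`. -/
def gSwap : grp := gT * gD * gD * gT

theorem coe_gSwap : ((gSwap : GL (Fin 2) ℂ) : Matrix (Fin 2) (Fin 2) ℂ) = !![0, 1; 1, 0] := by
  have h := invSqrtTwo_sq
  have hI := Complex.I_sq
  have hT : matT = invSqrtTwo • !![1, 1; 1, -1] := rfl
  change matT * matD * matD * matT = _
  rw [hT]
  ext i j
  fin_cases i <;> fin_cases j <;>
    simp [matD, Matrix.mul_apply, Fin.sum_univ_two]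
  · linear_combination invSqrtTwo ^ 2 * hI
  · linear_combination 2 * h - invSqrtTwo ^ 2 * hI
  · linear_combination 2 * h - invSqrtTwo ^ 2 * hI
  · linear_combination invSqrtTwo ^ 2 * hI

theorem subst_gSwap (f : Poly) : subst (gSwap : GL (Fin 2) ℂ) f = tau f := by
  have : subst (gSwap : GL (Fin 2) ℂ) = tau := by
    rw [coe_gSwap]
    ext i : 1
    fin_cases i <;> simp [tau, subst_X, Fin.sum_univ_two]
  rw [this]

theorem rho3_gSwap : (rho3 gSwap : ℂ) = -1 := by
  simp [gSwap, rho3_T, rho3_D]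

theorem neg_one_pow_twistExp (j : Fin 4) : (-1 : ℂ) ^ twistExp j = swapSign j := by
  fin_cases j <;> simp [twistExp, swapSign]
  norm_num

/-- The symmetric cube of the transposition reverses the four coordinates, and `ρ₃` contributes the
sign `(-1)^m`. -/
theorem hasSwapPattern {j : Fin 4} {d : ℕ} {F : Fin 4 → Poly} (hF : F ∈ covariants (rho j))
    (hd : IsHomogeneousVec F d) : HasSwapPattern (swapSign j) d F := by
  have h : ∀ r, tau (F r) = ∑ s, C (swapSign j * symCube !![0, 1; 1, 0] r s) * F s := fun r => by
    rw [← subst_gSwap, show subst (gSwap : GL (Fin 2) ℂ) (F r) = _ from hF gSwap r, coe_rho,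
      rho3_gSwap, neg_one_pow_twistExp, coe_gSwap]
    rfl
  have hε : swapSign j * swapSign j = 1 := by
    fin_cases j <;> simp [swapSign]
  have h0 := h 0
  have h1 := h 1
  simp [symCube, Fin.sum_univ_four] at h0 h1
  refine ⟨F 0, F 1, hd 0, hd 1, ?_⟩
  rw [h0, h1, ← smul_eq_C_mul, ← smul_eq_C_mul, smul_smul, smul_smul, hε, one_smul, one_smul]
  funext r
  fin_cases r <;> rfl

/-! ### The Hilbert function of the invariant ring -/

theorem homogeneousComponent_mul_left {f : Poly} {e : ℕ} (hf : f.IsHomogeneous e) (g : Poly)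
    (n : ℕ) : homogeneousComponent n (f * g) =
      if e ≤ n then f * homogeneousComponent (n - e) g else 0 := by
  let _ := gradedAlgebra (σ := Fin 2) (R := ℂ)
  have e : ∀ (φ : Poly) (i : ℕ), (DirectSum.decompose (homogeneousSubmodule (Fin 2) ℂ) φ i : Poly)
      = homogeneousComponent i φ := decomposition.decompose'_apply
  have := DirectSum.coe_decompose_mul_of_left_mem (𝒜 := homogeneousSubmodule (Fin 2) ℂ) n
    (a := f) (b := g) hf
  simpa only [e] using this

/-- The space of homogeneous invariants of degree `n`. -/
def invDeg (n : ℕ) : Submodule ℂ Poly :=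
  Subalgebra.toSubmodule invRing ⊓ homogeneousSubmodule (Fin 2) ℂ n

theorem mem_invDeg {n : ℕ} {f : Poly} : f ∈ invDeg n ↔ f ∈ invRing ∧ f.IsHomogeneous n := by
  simp [invDeg]

instance (n : ℕ) : FiniteDimensional ℂ (homogeneousSubmodule (Fin 2) ℂ n) :=
  Module.Finite.iff_fg.2 (homogeneousSubmodule_fg (Fin 2) ℂ n)

instance (n : ℕ) : FiniteDimensional ℂ (invDeg n) :=
  Submodule.finiteDimensional_of_le (inf_le_right : invDeg n ≤ homogeneousSubmodule (Fin 2) ℂ n)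

theorem homogeneousComponent_subst (A : Matrix (Fin 2) (Fin 2) ℂ) (n : ℕ) (f : Poly) :
    homogeneousComponent n (subst A f) = subst A (homogeneousComponent n f) := by
  conv_lhs => rw [← sum_homogeneousComponent f]
  rw [map_sum, map_sum]
  have h : ∀ i, homogeneousComponent n (subst A (homogeneousComponent i f)) =
      if i = n then subst A (homogeneousComponent n f) else 0 := fun i => by
    rw [homogeneousComponent_of_mem
      (subst_isHomogeneous A (homogeneousComponent_isHomogeneous i f))]
    by_cases hi : i = n
    · subst hi; simp
    · rw [if_neg hi, if_neg (Ne.symm hi)]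
  simp only [h]
  rw [Finset.sum_ite_eq' _ n]
  split_ifs with hn
  · rfl
  · rw [homogeneousComponent_eq_zero, map_zero]
    simpa using hn

theorem homogeneousComponent_mem_invDeg {f : Poly} (hf : f ∈ invRing) (n : ℕ) :
    homogeneousComponent n f ∈ invDeg n :=
  mem_invDeg.2 ⟨fun σ => by rw [← homogeneousComponent_subst, hf σ],
    homogeneousComponent_isHomogeneous n f⟩

theorem eq_single_of_coeff_ne_zero {n : ℕ} {f : Poly} (hf : f.IsHomogeneous n)
    {d : Fin 2 →₀ ℕ} (hd : coeff d f ≠ 0) (h1 : d 1 = 0) : d = Finsupp.single 0 n := by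
  have hdeg : d.degree = n := by_contra fun h => hd (hf.coeff_eq_zero h)
  have h0 : d 0 = n := by
    rw [← hdeg, Finsupp.degree_eq_sum, Fin.sum_univ_two, h1, add_zero]
  ext i
  fin_cases i
  · simpa using h0
  · simpa using h1

theorem eval_eq_coeff {n : ℕ} {f : Poly} (hf : f.IsHomogeneous n) :
    eval ![1, 0] f = coeff (Finsupp.single 0 n) f := by
  rw [eval_eq']
  have h : ∀ d ∈ f.support, d ≠ Finsupp.single 0 n →
      coeff d f * ∏ i, (![1, 0] : Fin 2 → ℂ) i ^ d i = 0 := fun d hd hne => by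
    have h1 : d 1 ≠ 0 := fun h1 => hne (eq_single_of_coeff_ne_zero hf (mem_support_iff.1 hd) h1)
    simp [Fin.prod_univ_two, h1]
  rw [Finset.sum_eq_single (Finsupp.single 0 n) h]
  · simp [Fin.prod_univ_two]
  · intro h
    rw [notMem_support_iff.1 h, zero_mul]

/-- The scalar matrix of order `8`, as an element of `𝔊`. -/
def gScalar : grp := gT * gD * gT * gD * gT * gD

theorem coe_gScalar : ((gScalar : GL (Fin 2) ℂ) : Matrix (Fin 2) (Fin 2) ℂ) =
    Matrix.diagonal fun _ => invSqrtTwo * (1 + Complex.I) := by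
  have h := invSqrtTwo_sq
  have hI := Complex.I_sq
  have hT : matT = invSqrtTwo • !![1, 1; 1, -1] := rfl
  change matT * matD * matT * matD * matT * matD = _
  rw [hT]
  ext i j
  fin_cases i <;> fin_cases j <;>
    simp [matD, Matrix.mul_apply, Fin.sum_univ_two]
  · linear_combination 2 * invSqrtTwo * (1 + Complex.I) * h - invSqrtTwo ^ 3 * hI
  · linear_combination invSqrtTwo ^ 3 * hI
  · linear_combination invSqrtTwo ^ 3 * hI
  · linear_combination 2 * invSqrtTwo * (1 + Complex.I) * h -
      invSqrtTwo ^ 3 * (Complex.I + 2) * hI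

/-- The value at `(1, 0)` is the coefficient of `x^n`, which the scalar `ζ = (1 + i)/√2` multiplies
by `ζ^n`. From `ζ² = i` one gets first `4 ∣ n`, then `8 ∣ n`. -/
theorem eight_dvd_of_eval_ne_zero {n : ℕ} {f : Poly} (hf : f ∈ invDeg n)
    (h : eval ![1, 0] f ≠ 0) : 8 ∣ n := by
  obtain ⟨hi, hn⟩ := mem_invDeg.1 hf
  rw [eval_eq_coeff hn] at h
  have h1 := congrArg (coeff (Finsupp.single 0 n)) (hi gScalar)
  rw [coe_gScalar, coeff_subst_diagonal] at h1
  have h2 : (invSqrtTwo * (1 + Complex.I)) ^ n = 1 := by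
    refine mul_right_cancel₀ h ?_
    simpa using h1
  have hz : (invSqrtTwo * (1 + Complex.I)) ^ 2 = Complex.I := by
    linear_combination (1 + Complex.I) ^ 2 * invSqrtTwo_sq + Complex.I_sq / 2
  have h3 : Complex.I ^ n = 1 := by
    rw [← hz, ← pow_mul, Nat.mul_comm, pow_mul, h2, one_pow]
  have h4 : n % 4 = 0 := by
    have := I_pow_inj (a := n) (b := 0) (by rw [h3, pow_zero])
    simpa using this
  obtain ⟨k, rfl⟩ := Nat.dvd_of_mod_eq_zero h4
  rw [show 4 * k = 2 * (2 * k) by ring, pow_mul, hz, pow_mul, Complex.I_sq] at h2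
  have hk : Even k := by
    by_contra hk
    rw [Nat.not_even_iff_odd] at hk
    rw [hk.neg_one_pow] at h2
    norm_num at h2
  obtain ⟨l, rfl⟩ := hk
  exact ⟨l, by ring⟩

/-- Invariance under `D` leaves only exponents of `y` divisible by `4`, and the vanishing excludes
exponent `0`. So `y⁴`, hence `Γ⁴`, divides `f`. -/
theorem exists_eq_Gam_mul {n : ℕ} {f : Poly} (hf : f ∈ invDeg n) (h : eval ![1, 0] f = 0) :
    ∃ g ∈ invRing, f = Gam ^ 4 * g := by
  obtain ⟨hi, hn⟩ := mem_invDeg.1 hf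
  rw [eval_eq_coeff hn] at h
  have hX : (X 1 : Poly) ^ 4 ∣ f := X1_pow_dvd fun d hd => by
    have h1 := congrArg (coeff d) (hi gD)
    rw [show ((gD : GL (Fin 2) ℂ) : Matrix (Fin 2) (Fin 2) ℂ) = matD from rfl,
      coeff_subst_D] at h1
    have h2 : Complex.I ^ d 1 = Complex.I ^ 0 := by
      rw [pow_zero]
      exact mul_right_cancel₀ hd (by rw [h1, one_mul])
    have h3 := I_pow_inj h2
    have h4 : d 1 ≠ 0 := fun h4 => hd (by rw [eq_single_of_coeff_ne_zero hn hd h4, h])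
    omega
  have hs := semiInv_zero_iff.2 hi
  obtain ⟨g, rfl⟩ := hs.Gam_pow_dvd hX
  refine ⟨g, semiInv_zero_iff.1 ?_, rfl⟩
  exact SemiInv.of_mul (pow_ne_zero _ Gam_ne_zero)
    ((semiInv_Gam.pow 4).congr (n := 0) (by norm_num)) hs

theorem Gam_pow_four_mem : Gam ^ 4 ∈ invRing :=
  semiInv_zero_iff.1 ((semiInv_Gam.pow 4).congr (by norm_num))

theorem W8_mem : W8 ∈ invRing := semiInv_zero_iff.1 semiInv_W8

/-- Multiplication by `Γ⁴`, on homogeneous invariants. -/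
def mulGam (n : ℕ) : invDeg n →ₗ[ℂ] invDeg (n + 24) :=
  ((LinearMap.mulLeft ℂ (Gam ^ 4)).comp (invDeg n).subtype).codRestrict _ fun f => by
    obtain ⟨hi, hn⟩ := mem_invDeg.1 f.2
    refine mem_invDeg.2 ⟨mul_mem Gam_pow_four_mem hi, ?_⟩
    rw [add_comm]
    exact (isHomogeneous_Gam.pow 4).mul hn

theorem coe_mulGam {n : ℕ} (f : invDeg n) : (mulGam n f : Poly) = Gam ^ 4 * (f : Poly) := rfl

theorem mulGam_injective (n : ℕ) : Function.Injective (mulGam n) := fun _ _ h =>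
  Subtype.ext (mul_left_cancel₀ (pow_ne_zero 4 Gam_ne_zero) (congrArg Subtype.val h))

/-- The value at `(1, 0)`, on homogeneous invariants. -/
def evalInv (n : ℕ) : invDeg n →ₗ[ℂ] ℂ := (aeval ![1, 0]).toLinearMap.comp (invDeg n).subtype

theorem evalInv_apply {n : ℕ} (f : invDeg n) : evalInv n f = eval ![1, 0] (f : Poly) := by
  simp [evalInv, aeval_eq_eval]

theorem finrank_range_evalInv (n : ℕ) :
    Module.finrank ℂ (LinearMap.range (evalInv n)) = if 8 ∣ n then 1 else 0 := by
  split_ifs with h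
  · obtain ⟨k, rfl⟩ := h
    have : LinearMap.range (evalInv (8 * k)) = ⊤ := by
      rw [LinearMap.range_eq_top]
      intro c
      have hW : W8 ^ k ∈ invDeg (8 * k) := mem_invDeg.2 ⟨pow_mem W8_mem k, isHomogeneous_W8.pow k⟩
      refine ⟨c • ⟨_, hW⟩, ?_⟩
      rw [map_smul, evalInv_apply]
      simp [W8]
    rw [this, finrank_top, Module.finrank_self]
  · have : LinearMap.range (evalInv n) = ⊥ := by
      rw [LinearMap.range_eq_bot]
      ext f
      rw [LinearMap.zero_apply, evalInv_apply]
      by_contra hf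
      exact h (eight_dvd_of_eval_ne_zero f.2 hf)
    rw [this, finrank_bot]

theorem finrank_ker_evalInv_of_lt {n : ℕ} (h : n < 24) :
    Module.finrank ℂ (LinearMap.ker (evalInv n)) = 0 := by
  have : LinearMap.ker (evalInv n) = ⊥ := by
    rw [LinearMap.ker_eq_bot']
    intro f hf
    rw [evalInv_apply] at hf
    obtain ⟨g, -, hg⟩ := exists_eq_Gam_mul f.2 hf
    have h1 := homogeneousComponent_mul_left (isHomogeneous_Gam.pow 4) g n
    rw [← hg, if_neg (by omega), homogeneousComponent_eq_self (mem_invDeg.1 f.2).2] at h1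
    exact Subtype.ext h1
  rw [this, finrank_bot]

theorem finrank_ker_evalInv (n : ℕ) :
    Module.finrank ℂ (LinearMap.ker (evalInv (n + 24))) = Module.finrank ℂ (invDeg n) := by
  have : LinearMap.ker (evalInv (n + 24)) = LinearMap.range (mulGam n) := by
    ext f
    rw [LinearMap.mem_ker, LinearMap.mem_range, evalInv_apply]
    constructor
    · intro hf
      obtain ⟨g, hgi, hg⟩ := exists_eq_Gam_mul f.2 hf
      -- The quotient `g` is not known to be homogeneous; its component of degree `n` serves
      -- instead.
      have h1 := homogeneousComponent_mul_left (isHomogeneous_Gam.pow 4) g (n + 24)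
      rw [← hg, if_pos (by norm_num), homogeneousComponent_eq_self (mem_invDeg.1 f.2).2] at h1
      rw [Nat.add_sub_cancel] at h1
      refine ⟨⟨_, homogeneousComponent_mem_invDeg hgi n⟩, Subtype.ext ?_⟩
      rw [coe_mulGam, h1]
    · rintro ⟨g, rfl⟩
      rw [coe_mulGam, map_mul]
      simp [Gam]
  rw [this, LinearMap.finrank_range_of_inj (mulGam_injective n)]

/-- Rank-nullity for evaluation at `(1, 0)`: the image contributes `1` exactly when `8 ∣ n`, where
`W8 ^ (n / 8)` takes the value `1`, and the kernel is a copy of degree `n - 24`. -/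
theorem finrank_invDeg (n : ℕ) :
    Module.finrank ℂ (invDeg n) = if 8 ∣ n then n / 24 + 1 else 0 := by
  induction n using Nat.strong_induction_on with
  | _ n ih =>
    have h := LinearMap.finrank_range_add_finrank_ker (evalInv n)
    rw [finrank_range_evalInv] at h
    rcases Nat.lt_or_ge n 24 with hn | hn
    · rw [finrank_ker_evalInv_of_lt hn] at h
      rw [← h, Nat.div_eq_of_lt hn, zero_add, add_zero]
    · obtain ⟨k, rfl⟩ := Nat.exists_eq_add_of_le' hn
      rw [finrank_ker_evalInv, ih k (by omega)] at h
      rw [← h]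
      split_ifs <;> omega

/-- The Hilbert series of the invariant ring. -/
def invSeries : PowerSeries ℤ := PowerSeries.mk fun n => (Module.finrank ℂ (invDeg n) : ℤ)

theorem invSeries_mul :
    invSeries * ((1 - (PowerSeries.X : PowerSeries ℤ) ^ 8) *
      (1 - (PowerSeries.X : PowerSeries ℤ) ^ 24)) = 1 := by
  have e : invSeries * ((1 - (PowerSeries.X : PowerSeries ℤ) ^ 8) *
      (1 - (PowerSeries.X : PowerSeries ℤ) ^ 24)) = invSeries - invSeries * PowerSeries.X ^ 8 -
      invSeries * PowerSeries.X ^ 24 + invSeries * PowerSeries.X ^ 32 := by ring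
  rw [e]
  ext n
  simp only [map_add, map_sub, PowerSeries.coeff_mul_X_pow', invSeries, PowerSeries.coeff_mk,
    PowerSeries.coeff_one, finrank_invDeg]
  split_ifs <;> push_cast <;> omega

/-! ### The Hilbert series of the covariants -/

/-- The coefficients of an element of degree `n` along a basis element of degree `e`. -/
def coeffSpace (n e : ℕ) : Submodule ℂ Poly := if e ≤ n then invDeg (n - e) else ⊥

theorem coeffSpace_of_le {n e : ℕ} (h : e ≤ n) : coeffSpace n e = invDeg (n - e) := if_pos h

theorem coeffSpace_of_not_le {n e : ℕ} (h : ¬ e ≤ n) : coeffSpace n e = ⊥ := if_neg h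

theorem coeffSpace_le_invDeg (n e : ℕ) : coeffSpace n e ≤ invDeg (n - e) := by
  by_cases h : e ≤ n
  · rw [coeffSpace_of_le h]
  · rw [coeffSpace_of_not_le h]; exact bot_le

theorem coeffSpace_le (n e : ℕ) : coeffSpace n e ≤ Subalgebra.toSubmodule invRing :=
  (coeffSpace_le_invDeg n e).trans inf_le_left

instance (n e : ℕ) : FiniteDimensional ℂ (coeffSpace n e) :=
  Submodule.finiteDimensional_of_le (coeffSpace_le_invDeg n e)

theorem finrank_coeffSpace (n e : ℕ) : (Module.finrank ℂ (coeffSpace n e) : ℤ) =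
    PowerSeries.coeff n (invSeries * PowerSeries.X ^ e) := by
  rw [PowerSeries.coeff_mul_X_pow']
  split_ifs with h
  · rw [coeffSpace_of_le h, invSeries, PowerSeries.coeff_mk]
  · rw [coeffSpace_of_not_le h, finrank_bot, Nat.cast_zero]

theorem mul_isHomogeneous_of_mem_coeffSpace {n e : ℕ} {a f : Poly} (ha : a ∈ coeffSpace n e)
    (hf : f.IsHomogeneous e) : (a * f).IsHomogeneous n := by
  unfold coeffSpace at ha
  split_ifs at ha with h
  · have := (mem_invDeg.1 ha).2.mul hf
    rwa [Nat.sub_add_cancel h] at this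
  · rw [(Submodule.mem_bot ℂ).1 ha, zero_mul]
    exact isHomogeneous_zero _ _ _

theorem exists_coeffSpace {a : Poly} (ha : a ∈ invRing) (n e : ℕ) :
    ∃ b ∈ coeffSpace n e, ∀ f : Poly, f.IsHomogeneous e →
      homogeneousComponent n (a * f) = b * f := by
  unfold coeffSpace
  split_ifs with h
  · refine ⟨_, homogeneousComponent_mem_invDeg ha (n - e), fun f hf => ?_⟩
    rw [mul_comm, homogeneousComponent_mul_left hf, if_pos h, mul_comm]
  · refine ⟨0, zero_mem _, fun f hf => ?_⟩
    rw [mul_comm, homogeneousComponent_mul_left hf, if_neg h, zero_mul]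

/-- The coefficients as invariants. -/
def coeffInv {n e : ℕ} (a : coeffSpace n e) : invRing := ⟨a, coeffSpace_le n e a.2⟩

/-- Linear combinations of degree `n` of homogeneous covariants of degrees `e k`. -/
def combine {j : Fin 4} (w : Fin 4 → covariants (rho j)) {e : Fin 4 → ℕ}
    (he : ∀ k, IsHomogeneousVec (w k : Fin 4 → Poly) (e k)) (n : ℕ) :
    (∀ k, coeffSpace n (e k)) →ₗ[ℂ] covariantsDeg (rho j) n where
  toFun a := ⟨(∑ k, coeffInv (a k) • w k : covariants (rho j)), (mem_covariantsDeg _ _ _).2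
    ⟨(∑ k, coeffInv (a k) • w k : covariants (rho j)).2, fun r => by
      rw [coe_sum_smul]
      exact IsHomogeneous.sum _ _ _ fun k _ =>
        mul_isHomogeneous_of_mem_coeffSpace (a k).2 (he k r)⟩⟩
  map_add' a b := by
    refine Subtype.ext (_root_.funext fun r => ?_)
    change (∑ k, coeffInv ((a + b) k) • w k : covariants (rho j)).1 r =
      (∑ k, coeffInv (a k) • w k : covariants (rho j)).1 r +
      (∑ k, coeffInv (b k) • w k : covariants (rho j)).1 r
    rw [coe_sum_smul, coe_sum_smul, coe_sum_smul, ← Finset.sum_add_distrib]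
    exact Finset.sum_congr rfl fun k _ => add_mul _ _ _
  map_smul' c a := by
    refine Subtype.ext (_root_.funext fun r => ?_)
    change (∑ k, coeffInv ((c • a) k) • w k : covariants (rho j)).1 r =
      c • (∑ k, coeffInv (a k) • w k : covariants (rho j)).1 r
    rw [coe_sum_smul, coe_sum_smul, Finset.smul_sum]
    exact Finset.sum_congr rfl fun k _ => smul_mul_assoc _ _ _

theorem coe_combine {j : Fin 4} (w : Fin 4 → covariants (rho j)) {e : Fin 4 → ℕ}
    (he : ∀ k, IsHomogeneousVec (w k : Fin 4 → Poly) (e k)) (n : ℕ)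
    (a : ∀ k, coeffSpace n (e k)) : (combine w he n a : Fin 4 → Poly) =
      (∑ k, coeffInv (a k) • w k : covariants (rho j)).1 := rfl

theorem combine_bijective {j : Fin 4} (w : Module.Basis (Fin 4) invRing (covariants (rho j)))
    {e : Fin 4 → ℕ} (he : ∀ k, IsHomogeneousVec (w k : Fin 4 → Poly) (e k)) (n : ℕ) :
    Function.Bijective (combine w he n) := by
  constructor
  · rw [injective_iff_map_eq_zero]
    intro a ha
    have h0 : ∑ k, coeffInv (a k) • w k = 0 := Subtype.ext <| by
      rw [← coe_combine w he n a, ha]; rfl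
    have := Fintype.linearIndependent_iff.1 w.linearIndependent _ h0
    exact _root_.funext fun k => Subtype.ext (congrArg (fun a : invRing => (a : Poly)) (this k))
  · rintro ⟨F, hF⟩
    obtain ⟨hc, hn⟩ := (mem_covariantsDeg _ _ _).1 hF
    -- Surjectivity: each coordinate of `F` is replaced by its component of degree `n - e k`, which
    -- does not change the degree `n` part of the sum.
    choose b hb hbf using fun k => exists_coeffSpace (w.repr ⟨F, hc⟩ k).2 n (e k)
    refine ⟨fun k => ⟨b k, hb k⟩, Subtype.ext (_root_.funext fun r => ?_)⟩
    change (∑ k, coeffInv ⟨b k, hb k⟩ • w k : covariants (rho j)).1 r = F r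
    have h1 := coe_sum_smul (fun k => w.repr ⟨F, hc⟩ k) w r
    rw [w.sum_repr] at h1
    rw [coe_sum_smul, ← homogeneousComponent_eq_self (hn r), show F r = _ from h1, map_sum]
    exact Finset.sum_congr rfl fun k _ => (hbf k _ (he k r)).symm

theorem hilbertSeries_eq {j : Fin 4} (w : Module.Basis (Fin 4) invRing (covariants (rho j)))
    {e : Fin 4 → ℕ} (he : ∀ k, IsHomogeneousVec (w k : Fin 4 → Poly) (e k)) :
    hilbertSeries (rho j) = invSeries * ∑ k, PowerSeries.X ^ e k := by
  ext n
  rw [hilbertSeries, PowerSeries.coeff_mk, Finset.mul_sum, map_sum,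
    ← (LinearEquiv.ofBijective _ (combine_bijective w he n)).finrank_eq,
    Module.finrank_pi_fintype, Nat.cast_sum]
  exact Finset.sum_congr rfl fun k _ => finrank_coeffSpace n (e k)

theorem finiteDimensional_covariantsDeg {m : ℕ} (ρ : grp →* GL (Fin m) ℂ) (n : ℕ) :
    FiniteDimensional ℂ (covariantsDeg ρ n) := by
  let f : covariantsDeg ρ n →ₗ[ℂ] (Fin m → homogeneousSubmodule (Fin 2) ℂ n) :=
    LinearMap.pi fun r => ((LinearMap.proj r).comp (covariantsDeg ρ n).subtype).codRestrict _
      fun F => ((mem_covariantsDeg _ _ _).1 F.2).2 r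
  refine FiniteDimensional.of_injective f fun F G h => Subtype.ext (_root_.funext fun r => ?_)
  exact congrArg Subtype.val (congrFun h r)

/-- The coefficient of `t^n` counts the indices with value `n`; bijections between the fibres are
glued to a permutation. -/
theorem exists_perm_of_sum_X_pow_eq {e d : Fin 4 → ℕ}
    (h : ∑ k, (PowerSeries.X : PowerSeries ℤ) ^ e k = ∑ k, PowerSeries.X ^ d k) :
    ∃ π : Equiv.Perm (Fin 4), ∀ k, e k = d (π k) := by
  have hc : ∀ n, Fintype.card {k // e k = n} = Fintype.card {k // d k = n} := fun n => by
    have := congrArg (PowerSeries.coeff n) h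
    simp only [map_sum, PowerSeries.coeff_X_pow, Finset.sum_boole] at this
    rw [Fintype.card_subtype, Fintype.card_subtype]
    simpa only [eq_comm, Nat.cast_inj] using this
  refine ⟨(Equiv.sigmaFiberEquiv e).symm.trans ((Equiv.sigmaCongrRight fun n =>
    Fintype.equivOfCardEq (hc n)).trans (Equiv.sigmaFiberEquiv d)), fun k => ?_⟩
  exact (Fintype.equivOfCardEq (hc (e k)) ⟨k, rfl⟩).2.symm

theorem exists_perm_degrees {j : Fin 4} (w₀ w : Module.Basis (Fin 4) invRing (covariants (rho j)))
    {d e : Fin 4 → ℕ} (hd : ∀ k, IsHomogeneousVec (w₀ k : Fin 4 → Poly) (d k))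
    (he : ∀ k, IsHomogeneousVec (w k : Fin 4 → Poly) (e k)) :
    ∃ π : Equiv.Perm (Fin 4), ∀ k, e k = d (π k) := by
  refine exists_perm_of_sum_X_pow_eq (mul_left_cancel₀ (a := invSeries) ?_ ?_)
  · intro h
    have := invSeries_mul
    rw [h, zero_mul] at this
    exact zero_ne_one this
  · rw [← hilbertSeries_eq w he, hilbertSeries_eq w₀ hd]

theorem coeff_hilbertSeries {j : Fin 4}
    (h : hilbertSeries (rho j) = invSeries * ∑ k, PowerSeries.X ^ degs j k) (n : ℕ)
    (hn : n < degs j 0 + 40) :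
    PowerSeries.coeff n (hilbertSeries (rho j)) =
        PowerSeries.coeff n (∑ l : Fin 5,
          PowerSeries.C (firstCoeffs j l) * PowerSeries.X ^ (degs j 0 + 8 * (l : ℕ))) := by
  rw [h, Finset.mul_sum, map_sum, map_sum]
  simp only [PowerSeries.coeff_mul_X_pow', invSeries, PowerSeries.coeff_mk, finrank_invDeg,
    PowerSeries.coeff_C, Fin.sum_univ_four, Fin.sum_univ_five]
  clear h
  revert n
  revert j
  -- With the dimensions replaced by the closed formula, finitely many integer identities remain.
  decide +kernel

/-! ### The basic covariants -/

/-- The monomial `a x^p y^q`. -/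
def mon (a : ℤ) (p q : ℕ) : Poly := (a : Poly) * X 0 ^ p * X 1 ^ q

theorem mon_isHomogeneous (a : ℤ) {p q n : ℕ} (h : p + q = n) : (mon a p q).IsHomogeneous n := by
  rw [← h, mon, ← map_intCast (C : ℂ →+* Poly)]
  exact (isHomogeneous_C_mul_X_pow _ 0 p).mul (isHomogeneous_X_pow 1 q)

theorem subst_D_mon (a : ℤ) (p : ℕ) {q e : ℕ} (h : q % 4 = e % 4) :
    subst matD (mon a p q) = C (Complex.I ^ e) * mon a p q := by
  have hI : Complex.I ^ e = Complex.I ^ q := by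
    rw [← Nat.div_add_mod e 4, ← Nat.div_add_mod q 4, h]
    simp only [pow_add, pow_mul, Complex.I_pow_four, one_pow]
  rw [hI]
  simp only [mon, map_mul, map_pow, map_intCast, subst_D_X0, subst_D_X1]
  ring

theorem subst_D_mon_add {f g : Poly} {e : ℕ} (hf : subst matD f = C (Complex.I ^ e) * f)
    (hg : subst matD g = C (Complex.I ^ e) * g) :
    subst matD (f + g) = C (Complex.I ^ e) * (f + g) := by
  rw [map_add, hf, hg, mul_add]

/-- Covariants of degrees `3`, `7`, `9`, `5` for `ρ₂₉`, `ρ₃₀`, `ρ₃₁`, `ρ₃₂`. -/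
def baseVec (i : Fin 4) : Fin 4 → Poly :=
  ![![mon 1 3 0, mon 1 2 1, mon 1 1 2, mon 1 0 3],
    ![mon 9 5 2 + mon 3 1 6, mon (-5) 4 3 + mon 1 0 7, mon 1 7 0 + mon (-5) 3 4,
      mon 3 6 1 + mon 9 2 5],
    ![mon (-3) 8 1 + mon (-42) 4 5 + mon 5 0 9, mon 12 7 2 + mon 28 3 6,
      mon (-28) 6 3 + mon (-12) 2 7, mon (-5) 9 0 + mon 42 5 4 + mon 3 1 8],
    ![mon 6 2 3, mon 1 5 0 + mon 1 1 4, mon (-1) 4 1 + mon (-1) 0 5, mon (-6) 3 2]] i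

/-- The degrees of the basic covariants. -/
def baseDeg (i : Fin 4) : ℕ := ![3, 7, 9, 5] i

theorem forall_fin_four {p : Fin 4 → Prop} : (∀ r, p r) ↔ p 0 ∧ p 1 ∧ p 2 ∧ p 3 :=
  ⟨fun h => ⟨h 0, h 1, h 2, h 3⟩, fun h r => by
    fin_cases r
    exacts [h.1, h.2.1, h.2.2.1, h.2.2.2]⟩

theorem baseVec_isHomogeneous (i : Fin 4) : IsHomogeneousVec (baseVec i) (baseDeg i) := by
  have h : ∀ (a : ℤ) {p q n : ℕ}, p + q = n → (mon a p q).IsHomogeneous n := mon_isHomogeneous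
  revert i
  simp only [IsHomogeneousVec, forall_fin_four, baseVec, baseDeg, Matrix.cons_val]
  refine ⟨⟨h _ ?_, h _ ?_, h _ ?_, h _ ?_⟩, ⟨.add (h _ ?_) (h _ ?_), .add (h _ ?_) (h _ ?_),
    .add (h _ ?_) (h _ ?_), .add (h _ ?_) (h _ ?_)⟩, ⟨.add (.add (h _ ?_) (h _ ?_)) (h _ ?_),
    .add (h _ ?_) (h _ ?_), .add (h _ ?_) (h _ ?_), .add (.add (h _ ?_) (h _ ?_)) (h _ ?_)⟩,
    ⟨h _ ?_, .add (h _ ?_) (h _ ?_), .add (h _ ?_) (h _ ?_), h _ ?_⟩⟩ <;> rfl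

theorem subst_D_baseVec (i r : Fin 4) :
    subst matD (baseVec i r) = C (Complex.I ^ (twistExp i + (r : ℕ))) * baseVec i r := by
  have h : ∀ (a : ℤ) (p : ℕ) {q e : ℕ}, q % 4 = e % 4 →
    subst matD (mon a p q) = C (Complex.I ^ e) * mon a p q := subst_D_mon
  revert i r
  simp only [forall_fin_four, baseVec, twistExp, Matrix.cons_val]
  refine ⟨⟨h _ _ rfl, h _ _ rfl, h _ _ rfl, h _ _ rfl⟩, ⟨?_, ?_, ?_, ?_⟩, ⟨?_, ?_, ?_, ?_⟩,
    ⟨h _ _ rfl, ?_, ?_, h _ _ rfl⟩⟩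
  · exact subst_D_mon_add (h _ _ rfl) (h _ _ rfl)
  · exact subst_D_mon_add (h _ _ rfl) (h _ _ rfl)
  · exact subst_D_mon_add (h _ _ rfl) (h _ _ rfl)
  · exact subst_D_mon_add (h _ _ rfl) (h _ _ rfl)
  · exact subst_D_mon_add (subst_D_mon_add (h _ _ rfl) (h _ _ rfl)) (h _ _ rfl)
  · exact subst_D_mon_add (h _ _ rfl) (h _ _ rfl)
  · exact subst_D_mon_add (h _ _ rfl) (h _ _ rfl)
  · exact subst_D_mon_add (subst_D_mon_add (h _ _ rfl) (h _ _ rfl)) (h _ _ rfl)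
  · exact subst_D_mon_add (h _ _ rfl) (h _ _ rfl)
  · exact subst_D_mon_add (h _ _ rfl) (h _ _ rfl)

/-- The substitution `x ↦ x + y`, `y ↦ x - y`. -/
def hadamard : Poly →ₐ[ℂ] Poly := aeval ![X 0 + X 1, X 0 - X 1]

/-- Splitting off the power of `1/√2` turns covariance under `T` into an identity with integer
coefficients. -/
theorem subst_T_eq_hadamard {f : Poly} {n : ℕ} (hf : f.IsHomogeneous n) :
    subst matT f = C (invSqrtTwo ^ n) * hadamard f := by
  conv_lhs => rw [f.as_sum]
  conv_rhs => rw [f.as_sum]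
  rw [map_sum, map_sum, Finset.mul_sum]
  refine Finset.sum_congr rfl fun d hd => ?_
  have hdeg : d 0 + d 1 = n := by
    by_contra h
    refine mem_support_iff.1 hd (hf.coeff_eq_zero ?_)
    rwa [Finsupp.degree_eq_sum, Fin.sum_univ_two]
  rw [monomial_eq, Finsupp.prod_fintype _ _ (by simp), Fin.prod_univ_two]
  simp only [map_mul, map_pow, subst_C, subst_T_X0, subst_T_X1, hadamard, aeval_C, aeval_X,
    Matrix.cons_val, mul_pow, algebraMap_eq]
  rw [← hdeg, pow_add]
  ring

theorem hadamard_mon (a : ℤ) (p q : ℕ) :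
    hadamard (mon a p q) = (a : Poly) * (X 0 + X 1) ^ p * (X 0 - X 1) ^ q := by
  simp only [mon, hadamard, map_mul, map_pow, map_intCast, aeval_X, Matrix.cons_val]

/-- The factors `1, 4, 8, 2` are `2^((d - 3)/2)` for the degrees `d = 3, 7, 9, 5`; they turn
`(1/√2)^d` into the `1/(2√2)` of `ρ₂₉(T)`. -/
theorem hadamard_baseVec (i r : Fin 4) : hadamard (baseVec i r) = (![1, 4, 8, 2] i : Poly) *
    ∑ s, ((!![1, 3, 3, 1; 1, 1, -1, -1; 1, -1, -1, 1; 1, -3, 3, -1] :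
      Matrix (Fin 4) (Fin 4) ℤ) r s : Poly) * baseVec i s := by
  revert i r
  simp only [forall_fin_four, Fin.sum_univ_four, baseVec, Matrix.cons_val, map_add, hadamard_mon]
  simp only [mon, Matrix.of_apply, Matrix.cons_val]
  push_cast
  refine ⟨⟨?_, ?_, ?_, ?_⟩, ⟨?_, ?_, ?_, ?_⟩, ⟨?_, ?_, ?_, ?_⟩, ⟨?_, ?_, ?_, ?_⟩⟩ <;> ring

theorem subst_T_baseVec (i r : Fin 4) : subst matT (baseVec i r) =
    ∑ s, C ((rho i gT : Matrix (Fin 4) (Fin 4) ℂ) r s) * baseVec i s := by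
  have hk : (C (invSqrtTwo ^ baseDeg i) : Poly) * (![1, 4, 8, 2] i : Poly) =
      C (2 * ((Real.sqrt 2 : ℝ) : ℂ))⁻¹ := by
    have h := invSqrtTwo_sq
    have hd : invSqrtTwo ^ baseDeg i * ![1, 4, 8, 2] i = (2 * ((Real.sqrt 2 : ℝ) : ℂ))⁻¹ := by
      rw [mul_inv]
      change _ = _ * invSqrtTwo
      revert i
      simp only [forall_fin_four, baseDeg, Matrix.cons_val]
      set s := invSqrtTwo
      refine ⟨?_, ?_, ?_, ?_⟩
      · linear_combination s * h
      · linear_combination 4 * s * (s ^ 4 + s ^ 2 / 2 + 1 / 4) * h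
      · linear_combination 8 * s * (s ^ 6 + s ^ 4 / 2 + s ^ 2 / 4 + 1 / 8) * h
      · linear_combination 2 * s * (s ^ 2 + 1 / 2) * h
    rw [← hd, C_mul]
    congr 1
    clear hd
    revert i
    simp only [forall_fin_four, Matrix.cons_val, map_ofNat, C_1, and_self]
  rw [subst_T_eq_hadamard (baseVec_isHomogeneous i r), hadamard_baseVec, ← mul_assoc, hk,
    Finset.mul_sum, rho_T]
  refine Finset.sum_congr rfl fun s _ => ?_
  rw [← mul_assoc, ← map_intCast (C : ℂ →+* Poly), ← C_mul, Matrix.smul_apply, smul_eq_mul]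
  congr 3
  fin_cases r <;> fin_cases s <;> simp

theorem baseVec_mem (i : Fin 4) : baseVec i ∈ covariants (rho i) := by
  refine mem_covariants_of_gen (fun r => ?_) (fun r => ?_)
  · exact subst_T_baseVec i r
  · rw [subst_D_baseVec, rho_D, Finset.sum_eq_single r]
    · rw [Matrix.diagonal_apply_eq]
    · intro s _ hs
      rw [Matrix.diagonal_apply_ne' _ hs, C_0, zero_mul]
    · simp

/-- A factor of weight `n` shifts the twist by `n` modulo `4`; this moves the basic covariants
between the four modules. -/
theorem semiInv_mul_mem {i j : Fin 4} {n : ℕ} {f : Poly} {F : Fin 4 → Poly} (hf : SemiInv n f)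
    (hF : F ∈ covariants (rho i)) (h : (n + twistExp i) % 4 = twistExp j % 4) :
    (fun r => f * F r) ∈ covariants (rho j) := fun σ r => by
  have hc : (rho3 σ : ℂ) ^ twistExp j = (rho3 σ : ℂ) ^ n * (rho3 σ : ℂ) ^ twistExp i := by
    rw [← pow_add, ← Nat.div_add_mod (n + twistExp i) 4, ← Nat.div_add_mod (twistExp j) 4, h]
    simp only [pow_add, pow_mul, rho3_pow_four, one_pow]
  rw [map_mul, hf σ, hF σ r, Finset.mul_sum]
  simp only [coe_rho, hc, Matrix.smul_apply, smul_eq_mul, C_mul]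
  exact Finset.sum_congr rfl fun s _ => by ring

/-- The basic covariant that enters the `k`-th basis element. -/
def basisIdx (j : Fin 4) : Fin 4 → Fin 4 :=
  ![![0, 3, 1, 2], ![1, 0, 2, 3], ![2, 0, 3, 1], ![3, 1, 0, 2]] j

/-- The power of `Γ` that enters the `k`-th basis element. -/
def basisExp (j : Fin 4) : Fin 4 → ℕ :=
  ![![0, 1, 2, 3], ![0, 2, 1, 3], ![0, 1, 2, 3], ![0, 1, 3, 2]] j

/-- The determinants of the basic covariants in the order `basisIdx j` are
`baseDetConst j * Δ²`. -/
def baseDetConst (j : Fin 4) : ℂ := ![-5, 5, 5, -5] j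

/-- The factor of the `k`-th basis element. -/
def basisFactor (j k : Fin 4) : Poly :=
  C (if k = 0 then detConst j / baseDetConst j else 1) * Gam ^ basisExp j k

/-- A direct expansion; the degrees agree as `3 + 5 + 7 + 9 = 24`. The sign is that of the order in
which `basisIdx j` lists the columns. -/
theorem det_baseVec (j : Fin 4) :
    (colMat fun k => baseVec (basisIdx j k)).det = C (baseDetConst j) * Del ^ 2 := by
  fin_cases j <;>
    simp [Matrix.det_succ_row_zero, Fin.sum_univ_succ, Fin.succAbove, colMat, basisIdx, baseVec,
      mon, baseDetConst, Del] <;> simp only [map_ofNat] <;> ring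

/-- The elements of the explicit basis. -/
def basisVec (j k : Fin 4) : Fin 4 → Poly := fun r => basisFactor j k * baseVec (basisIdx j k) r

theorem semiInv_basisFactor (j k : Fin 4) : SemiInv (basisExp j k) (basisFactor j k) := by
  have h := semiInv_Gam.pow (basisExp j k)
  rw [one_mul] at h
  intro σ
  rw [basisFactor, map_mul, subst_C, h σ]
  ring

theorem basisVec_mem (j k : Fin 4) : basisVec j k ∈ covariants (rho j) :=
  semiInv_mul_mem (semiInv_basisFactor j k) (baseVec_mem _)
    (by fin_cases j <;> fin_cases k <;> rfl)

theorem basisVec_isHomogeneous (j k : Fin 4) : IsHomogeneousVec (basisVec j k) (degs j k) := by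
  intro r
  have h := ((isHomogeneous_Gam.pow (basisExp j k)).C_mul
    (if k = 0 then detConst j / baseDetConst j else 1)).mul
      (baseVec_isHomogeneous (basisIdx j k) r)
  have hd : 6 * basisExp j k + baseDeg (basisIdx j k) = degs j k := by
    fin_cases j <;> fin_cases k <;> rfl
  rw [hd] at h
  exact h

/-- The column factors come out of the determinant: the powers of `Γ` have exponents summing to `6`,
and the scalar on the first column adjusts `±5` to the tabulated constant. -/
theorem det_basisVec (j : Fin 4) :
    (colMat (basisVec j)).det = C (detConst j) * (Del ^ 2 * Gam ^ 6) := by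
  have h : (colMat (basisVec j)).det =
      (∏ k, basisFactor j k) * (colMat fun k => baseVec (basisIdx j k)).det :=
    Matrix.det_mul_row (basisFactor j) (colMat fun k => baseVec (basisIdx j k))
  have hc : C (detConst j / baseDetConst j) * C (baseDetConst j) = (C (detConst j) : Poly) := by
    rw [← C_mul, div_mul_cancel₀]
    fin_cases j <;> simp [baseDetConst]
  have he : basisExp j 1 + basisExp j 2 + basisExp j 3 = 6 ∧ basisExp j 0 = 0 := by
    fin_cases j <;> decide
  have hp : ∏ k, basisFactor j k = C (detConst j / baseDetConst j) * Gam ^ 6 := by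
    rw [Fin.prod_univ_four, ← he.1, pow_add, pow_add]
    simp [basisFactor, he.2]
    ring
  rw [h, hp, det_baseVec, ← hc]
  ring

theorem detConst_ne_zero (j : Fin 4) : detConst j ≠ 0 := by
  fin_cases j <;> simp [detConst]

theorem totalDegree_C_mul_Del_sq_mul_Gam_pow {c : ℂ} (hc : c ≠ 0) :
    (C c * (Del ^ 2 * Gam ^ 6)).totalDegree = 60 :=
  (((isHomogeneous_Del.pow 2).mul (isHomogeneous_Gam.pow 6)).C_mul c).totalDegree
    (mul_ne_zero (by simpa using hc) Del_sq_mul_Gam_pow_ne_zero)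

theorem totalDegree_J : J.totalDegree = 30 :=
  (isHomogeneous_Del.mul (isHomogeneous_Gam.pow 3)).totalDegree
    (mul_ne_zero Del_ne_zero (pow_ne_zero _ Gam_ne_zero))

end G9

end

/-! ### The theorem for all four representations -/

theorem mainTheorem5 (j : Fin 4) :
    -- a homogeneous basis with the tabulated degrees, determinant and symmetry
    (∃ w : Module.Basis (Fin 4) G9.invRing (G9.covariants (G9.rho j)),
      (∀ k, G9.IsHomogeneousVec (w k : Fin 4 → G9.Poly) (G9.degs j k)) ∧
      G9.colDet w = MvPolynomial.C (G9.detConst j) * G9.J ^ 2 ∧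
      G9.colDet w = MvPolynomial.C (G9.detConst j) * (G9.Del ^ 2 * G9.Gam ^ 6) ∧
      (G9.colDet w).totalDegree = ∑ k, G9.degs j k ∧
      (G9.colDet w).totalDegree = 60 ∧
      ∀ k, G9.HasSwapPattern (G9.swapSign j) (G9.degs j k) (w k : Fin 4 → G9.Poly)) ∧
    -- the same for every homogeneous basis, up to the order and the constant
    (∀ (w : Module.Basis (Fin 4) G9.invRing (G9.covariants (G9.rho j))) (e : Fin 4 → ℕ),
      (∀ k, G9.IsHomogeneousVec (w k : Fin 4 → G9.Poly) (e k)) →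
      (∃ π : Equiv.Perm (Fin 4), ∀ k, e k = G9.degs j (π k)) ∧
      (∃ c : ℂ, c ≠ 0 ∧ G9.colDet w = MvPolynomial.C c * (G9.Del ^ 2 * G9.Gam ^ 6)) ∧
      ∀ k, G9.HasSwapPattern (G9.swapSign j) (e k) (w k : Fin 4 → G9.Poly)) ∧
    -- the Hilbert series
    (∀ n, FiniteDimensional ℂ (G9.covariantsDeg (G9.rho j) n)) ∧
    G9.hilbertSeries (G9.rho j) *
        ((1 - (PowerSeries.X : PowerSeries ℤ) ^ 8) * (1 - (PowerSeries.X : PowerSeries ℤ) ^ 24))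
      = ∑ k, (PowerSeries.X : PowerSeries ℤ) ^ (G9.degs j k) ∧
    (∀ n < G9.degs j 0 + 40,
      PowerSeries.coeff n (G9.hilbertSeries (G9.rho j)) =
        PowerSeries.coeff n (∑ l : Fin 5,
          PowerSeries.C (G9.firstCoeffs j l) * PowerSeries.X ^ (G9.degs j 0 + 8 * (l : ℕ)))) ∧
    G9.J.totalDegree = 30 := by
  open G9 in
  obtain ⟨w, hw⟩ := exists_basis_of_det (detConst_ne_zero j)
    (fun k => ⟨basisVec j k, basisVec_mem j k⟩) (det_basisVec j)
  have hh : ∀ k, IsHomogeneousVec (w k : Fin 4 → Poly) (degs j k) := fun k => by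
    rw [hw k]; exact basisVec_isHomogeneous j k
  have hdet : colDet w = C (detConst j) * (Del ^ 2 * Gam ^ 6) := by
    rw [show ⇑w = _ from _root_.funext hw]; exact det_basisVec j
  have hJ : J ^ 2 = Del ^ 2 * Gam ^ 6 := by rw [J]; ring
  have hdeg : (colDet w).totalDegree = 60 := by
    rw [hdet]; exact totalDegree_C_mul_Del_sq_mul_Gam_pow (detConst_ne_zero j)
  have hsum : ∑ k, degs j k = 60 := by
    fin_cases j <;> rfl
  have hser := hilbertSeries_eq w hh
  refine ⟨⟨w, hh, by rw [hdet, hJ], hdet, by rw [hdeg, hsum], hdeg,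
      fun k => hasSwapPattern (w k).2 (hh k)⟩,
    fun w' e he => ⟨exists_perm_degrees w w' hh he, colDet_basis (detConst_ne_zero j) w w' hdet,
      fun k => hasSwapPattern (w' k).2 (he k)⟩,
    finiteDimensional_covariantsDeg _, ?_, coeff_hilbertSeries hser, totalDegree_J⟩
  rw [hser, mul_right_comm, invSeries_mul, one_mul]
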